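/- Let $R$ be an associative unital ring and let $V$ be a left $R$-module. Write $\mathrm{Gen}(V)$ for the class of modules $X$ admitting an epimorphism $V^{(I)}\twoheadrightarrow X$ for some set $I$, $\mathrm{Pres}(V)$ for the class of modules $X$ admitting an exact sequence $V^{(J)}\to V^{(I)}\to X\to 0$ for some sets $I,J$, and $\overline{\mathrm{Gen}}(V)$ for the class of modules that embed in a module of $\mathrm{Gen}(V)$. An object $V$ of an abelian category $\mathcal{A}$ with coproducts is called classical $1$-tilting if $\mathrm{Gen}(V)=\mathrm{Ker}\,\mathrm{Ext}^1_{\mathcal{A}}(V,-)$ and the canonical map $\mathrm{Hom}_{\mathcal{A}}(V,V)^{(I)}\to\mathrm{Hom}_{\mathcal{A}}(V,V^{(I)})$ is bijective for every set $I$. For a torsion pair $\mathbf{t}=(\mathcal{T},\mathcal{F})$ in a Grothendieck category $\mathcal{G}$, let $\mathcal{H}_{\mathbf{t}}(\mathcal{G})$ be the full subcategory of the derived category $\mathcal{D}(\mathcal{G})$ formed by the complexes $X$ with $H^i(X)=0$ for $i\neq -1,0$, $H^{0}(X)\in\mathcal{T}$ and $H^{-1}(X)\in\mathcal{F}$ (the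 heart of the associated Happel--Reiten--Smalø t-structure, which is an abelian category with coproducts); put $\mathcal{H}_{\mathbf{t}}=\mathcal{H}_{\mathbf{t}}(R\text{-Mod})$. A progenerator is a compact projective generator. Consider the following conditions: 1) $V$ is a classical $1$-tilting $R$-module; 2) $\mathbf{t}=(\mathrm{Pres}(V),\mathrm{Ker}\,\mathrm{Hom}_R(V,-))$ is a torsion pair in $R\text{-Mod}$ and the stalk complex $V[0]$ is a progenerator of $\mathcal{H}_{\mathbf{t}}$; 3) $V$ is finitely presented and a) $\mathcal{T}:=\mathrm{Pres}(V)=\mathrm{Gen}(V)\subseteq\mathrm{Ker}\,\mathrm{Ext}^1_R(V,-)$; b) $\mathrm{Ext}^2_R(V,-)$ vanishes on $\mathcal{F}:=\mathrm{Ker}\,\mathrm{Hom}_R(V,-)$; c) every module of $\mathcal{F}$ embeds in a module of $\mathcal{T}$. Then 1) implies 2), and 2) is equivalent to 3). Moreover, when 2) or 3) holds, $\mathcal{G}:=\overline{\mathrm{Gen}}(V)$ is a Grothendieck category, $\mathcal{T}$ and $\mathcal{F}$ are contained in $\mathcal{G}$ and $\mathbf{t}=(\mathcal{T},\mathcal{F})$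 is also a torsion pair in $\mathcal{G}$, $V$ is a classical $1$-tilting object of $\mathcal{G}$, and the canonical functor $\mathcal{D}(\mathcal{G})\to\mathcal{D}(R)$ induced by the exact inclusion $\mathcal{G}\hookrightarrow R\text{-Mod}$ restricts to an equivalence of categories $\mathcal{H}_{\mathbf{t}}(\mathcal{G})\to\mathcal{H}_{\mathbf{t}}$. -/

import Mathlib

open CategoryTheory CategoryTheory.Limits DirectSum

universe t w v u

noncomputable section

namespace TiltingHeart

section Objects

variable {C : Type u} [Category.{v} C]

section Preadditive

variable [Preadditive C]

open scoped Classical in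
/-- For a cocone `c` over a discrete family `X`, the canonical homomorphism
`⨁ i, Hom(P, X i) → Hom(P, c.pt)`. -/
def coproductComparison (P : C) {I : Type t} {X : I → C} (c : Cofan X) :
    (⨁ i, (P ⟶ X i)) →+ (P ⟶ c.pt) :=
  DirectSum.toAddMonoid fun i => Preadditive.rightComp P (c.inj i)

/-- `P` is compact: `Hom(P, -)` preserves all coproducts indexed by types in `Type t`. -/
def IsCompactObject (P : C) : Prop :=
  ∀ (I : Type t) (X : I → C) (c : Cofan X), IsColimit c →
    Function.Bijective (coproductComparison P c)

/-- `V` is self-small: `Hom(V, V)^(I) → Hom(V, V^(I))` is an isomorphism for all sets `I`. -/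
def IsSelfSmall (V : C) : Prop :=
  ∀ (I : Type v) (c : Cofan fun _ : I => V), IsColimit c →
    Function.Bijective (coproductComparison V c)

/-- `P` is a progenerator: a compact projective generator. -/
structure IsProgenerator (P : C) : Prop where
  projective : Projective P
  compact : IsCompactObject.{t} P
  generator : IsSeparator P

/-- The class `Ker Hom(V, -)`. -/
def kerHom (V : C) : ObjectProperty C := fun X => ∀ f : V ⟶ X, f = 0

end Preadditive

/-- `Gen V`: the objects `X` with an epimorphism `V^(I) ⟶ X` for some set `I`. -/
def gen (V : C) : ObjectProperty C := fun X =>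
  ∃ (I : Type v) (c : Cofan fun _ : I => V) (_ : IsColimit c) (p : c.pt ⟶ X), Epi p

/-- The `V`-subgenerated objects: those embedding in an object of `Gen V`. -/
def subgen (V : C) : ObjectProperty C := fun X =>
  ∃ (Y : C) (_ : gen V Y) (i : X ⟶ Y), Mono i

variable [Abelian C]

/-- `Pres V`: the objects `X` with an exact sequence `V^(J) ⟶ V^(I) ⟶ X ⟶ 0`
for some sets `I`, `J`. -/
def pres (V : C) : ObjectProperty C := fun X =>
  ∃ (I J : Type v) (c : Cofan fun _ : I => V) (_ : IsColimit c)
    (d : Cofan fun _ : J => V) (_ : IsColimit d)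
    (f : d.pt ⟶ c.pt) (p : c.pt ⟶ X) (h : f ≫ p = 0),
    (ShortComplex.mk f p h).Exact ∧ Epi p

/-- The class `Ker Ext^n(V, -)`. -/
def kerExt (n : ℕ) (V : C) : ObjectProperty C := fun X =>
  haveI := HasExt.standard C
  Subsingleton (Abelian.Ext.{max u v} V X n)

/-- `V` is classical 1-tilting: `Gen V = Ker Ext^1(V, -)` and `V` is self-small. -/
structure IsClassicalOneTilting (V : C) : Prop where
  gen_eq : gen V = kerExt 1 V
  selfSmall : IsSelfSmall V

/-- `(T, F)` is a torsion pair in the abelian category `C`. -/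
structure IsTorsionPair (T F : ObjectProperty C) : Prop where
  hom_eq_zero : ∀ ⦃X Y : C⦄, T X → F Y → ∀ f : X ⟶ Y, f = 0
  exists_shortExact : ∀ X : C, ∃ (A B : C) (_ : T A) (_ : F B) (i : A ⟶ X) (p : X ⟶ B)
    (h : i ≫ p = 0), (ShortComplex.mk i p h).ShortExact

section Heart

variable [HasDerivedCategory.{w} C]

/-- The aisle `{X ∈ D^{≤ 0} | H^0(X) ∈ T}`. -/
def aisle (T : ObjectProperty C) : ObjectProperty (DerivedCategory C) := fun X =>
  X.IsLE 0 ∧ T ((DerivedCategory.homologyFunctor C 0).obj X)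

/-- The co-aisle `{X ∈ D^{≥ -1} | H^{-1}(X) ∈ F}`. -/
def coaisle (F : ObjectProperty C) : ObjectProperty (DerivedCategory C) := fun X =>
  X.IsGE (-1) ∧ F ((DerivedCategory.homologyFunctor C (-1)).obj X)

/-- The heart of the Happel-Reiten-Smalø t-structure of the pair `(T, F)`. -/
def heart (T F : ObjectProperty C) : ObjectProperty (DerivedCategory C) :=
  aisle T ⊓ coaisle F

end Heart

end Objects

section Subgenerated

variable {C : Type u} [Category.{v} C]

lemma gen_of_epi {V X Y : C} (f : X ⟶ Y) [Epi f] (h : gen V X) : gen V Y := by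
  obtain ⟨I, c, hc, p, hp⟩ := h
  exact ⟨I, c, hc, p ≫ f, epi_comp _ _⟩

lemma gen_self (V : C) : gen V V := by
  refine ⟨PUnit, Cofan.mk V fun _ => 𝟙 V, ?_, 𝟙 V, (inferInstance : Epi (𝟙 V))⟩
  exact Cofan.IsColimit.mk _ (fun s => s.inj PUnit.unit) (fun s j => by simp)
    (fun s m hm => by simpa using hm PUnit.unit)

lemma subgen_self (V : C) : subgen V V := ⟨V, gen_self V, 𝟙 V, inferInstance⟩

variable [Abelian C]

lemma gen_biprod {V X Y : C} (hX : gen V X) (hY : gen V Y) : gen V (X ⊞ Y) := by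
  obtain ⟨I, c, hc, p, hp⟩ := hX
  obtain ⟨J, d, hd, q, hq⟩ := hY
  have key := Cofan.combPairIsColimit hc hd (BinaryBiproduct.isColimit c.pt d.pt)
  have e : (Sum.elim (fun _ : I => V) (fun _ : J => V)) = fun _ => V := by
    funext i; cases i <;> rfl
  have hmap : Epi (biprod.map p q) := inferInstance
  revert key
  generalize Cofan.combPairHoms c d _ = φ
  revert φ
  rw [e]
  intro φ key
  exact ⟨I ⊕ J, _, key, biprod.map p q, hmap⟩

instance (V : C) : (subgen V).IsClosedUnderSubobjects where
  prop_of_mono f _ := by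
    rintro ⟨Z, hZ, i, hi⟩
    exact ⟨Z, hZ, f ≫ i, mono_comp _ _⟩

instance (V : C) : (subgen V).IsClosedUnderQuotients where
  prop_of_epi f _ := by
    rintro ⟨Z, hZ, i, hi⟩
    exact ⟨pushout f i, gen_of_epi (pushout.inr f i) hZ, pushout.inl f i, inferInstance⟩

instance (V : C) : (subgen V).ContainsZero where
  exists_zero := by
    obtain ⟨Z, hZ⟩ := HasZeroObject.zero (C := C)
    have : Mono (0 : Z ⟶ V) := ⟨fun _ _ _ => hZ.eq_of_tgt _ _⟩
    exact ⟨Z, hZ, (subgen V).prop_of_mono (0 : Z ⟶ V) (subgen_self V)⟩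

instance (V : C) : (subgen V).IsClosedUnderBinaryProducts where
  limitsOfShape_le := by
    rintro X ⟨p⟩
    obtain ⟨Y₁, h₁, i₁, _⟩ := p.prop_diag_obj ⟨WalkingPair.left⟩
    obtain ⟨Y₂, h₂, i₂, _⟩ := p.prop_diag_obj ⟨WalkingPair.right⟩
    refine ⟨Y₁ ⊞ Y₂, gen_biprod h₁ h₂,
      biprod.lift (p.π.app ⟨WalkingPair.left⟩ ≫ i₁) (p.π.app ⟨WalkingPair.right⟩ ≫ i₂), ?_⟩
    refine Preadditive.mono_of_cancel_zero _ fun g hg => ?_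
    have e₁ := hg =≫ biprod.fst
    have e₂ := hg =≫ biprod.snd
    simp only [Category.assoc, biprod.lift_fst, biprod.lift_snd, zero_comp] at e₁ e₂
    rw [← Category.assoc] at e₁ e₂
    refine p.isLimit.hom_ext ?_
    rintro ⟨_ | _⟩
    · simpa using (cancel_mono i₁).1 (e₁.trans zero_comp.symm)
    · simpa using (cancel_mono i₂).1 (e₂.trans zero_comp.symm)

instance (V : C) : (subgen V).IsClosedUnderFiniteProducts :=
  ObjectProperty.IsClosedUnderFiniteProducts.mk'

/-- The full subcategory of `V`-subgenerated objects; it is abelian. -/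
abbrev Subgen (V : C) := (subgen V).FullSubcategory

/-- `V` as an object of the category of `V`-subgenerated objects. -/
abbrev Subgen.self (V : C) : Subgen V := ⟨V, subgen_self V⟩

/-- The inclusion of the category of `V`-subgenerated objects. -/
abbrev Subgen.incl (V : C) : Subgen V ⥤ C := (subgen V).ι

instance (V : C) : PreservesFiniteLimits (Subgen.incl V) :=
  have := (subgen V).preservesKernels_ι
  Functor.preservesFiniteLimits_of_preservesKernels _

instance (V : C) : PreservesFiniteColimits (Subgen.incl V) :=
  have := (subgen V).preservesCokernels_ι
  Functor.preservesFiniteColimits_of_preservesCokernels _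

end Subgenerated

section Conditions

variable {R : Type u} [Ring R] (V : ModuleCat.{u} R)

/-- `(Pres V, Ker Hom(V, -))` is a torsion pair and the stalk complex `V[0]` is a progenerator
of its heart. -/
def StalkIsProgenerator [HasDerivedCategory.{w} (ModuleCat.{u} R)] : Prop :=
  IsTorsionPair (pres V) (kerHom V) ∧
    ∃ h : heart (pres V) (kerHom V) ((DerivedCategory.singleFunctor (ModuleCat.{u} R) 0).obj V),
      IsProgenerator.{u}
        (⟨_, h⟩ : (heart (pres V) (kerHom V)).FullSubcategory)

/-- `V` is finitely presented, `Pres V = Gen V ⊆ Ker Ext^1(V, -)`, `Ext^2(V, -)` vanishes on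
`Ker Hom(V, -)`, and every module of `Ker Hom(V, -)` embeds in a module of `Pres V`. -/
structure IsStalkProgeneratorModule : Prop where
  finitePresentation : Module.FinitePresentation R V
  pres_eq_gen : pres V = gen V
  gen_le_kerExt_one : gen V ≤ kerExt 1 V
  kerHom_le_kerExt_two : kerHom V ≤ kerExt 2 V
  embeds : ∀ F : ModuleCat.{u} R, kerHom V F →
    ∃ (T : ModuleCat.{u} R) (_ : pres V T) (i : F ⟶ T), Mono i

/-- The torsion class `Pres V`, regarded inside the category of `V`-subgenerated modules. -/
abbrev torsionIn : ObjectProperty (Subgen V) := (pres V).inverseImage (Subgen.incl V)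

/-- The class `Ker Hom(V, -)`, regarded inside the category of `V`-subgenerated modules. -/
abbrev torsionFreeIn : ObjectProperty (Subgen V) := (kerHom V).inverseImage (Subgen.incl V)

end Conditions

end TiltingHeart

end

noncomputable section

namespace TiltingHeart

/-!
Every object of the heart is an extension of `T[0]` by `F[1]` with `T` torsion and `F` torsion-free.
Since `Ext¹(V, -)` vanishes on torsion modules and `Ext²(V, -)` on torsion-free ones, no nonzero map
goes from `V[0]` to the shifted aisle, which makes `V[0]` projective in the heart. It generates the
heart: torsion modules are quotients of copowers of `V`, and embedding `F` in a torsion module `T`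
exhibits `F[1]` as the cofibre of `T[0] ⟶ (T / F)[0]`, hence as a quotient of `(T / F)[0]`. As every
object of the heart is thus a quotient of a copower of `V[0]`, compactness of `V[0]` reduces to maps
from `V` to its own copowers.

Conversely, if `V[0]` is a progenerator, the vanishing of the `Ext` groups is its projectivity
tested on stalk complexes. Compactness makes `Hom(V, -)` and `Ext¹(V, -)` detect at a finite stage
that a directed system of quotients has colimit zero. Applied to the quotients of `V` by its
finitely generated submodules, and then to torsion-free quotients of the kernel of a map `Rⁿ ⟶ V`,
this shows that `V` is finitely presented.

The functor between the hearts is fully faithful because, on either side, a heart object is the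
cofibre of a map `M[0] ⟶ V^(I)[0]` with `M` torsion, and the maps from `V` to `B[1]`, for `B`
torsion-free embedded in a torsion object `A`, are the maps from `V` to `A / B` modulo those to `A`.
It is essentially surjective because the torsion classes are the same.
-/

open DerivedCategory Pretriangulated

section Resolution

open CochainComplex.HomComplex

variable {C : Type u} [Category.{v} C] [Abelian C]

/-- The morphism of complexes from the stalk of the `p`-cycles of `L`, placed in degree `p`,
to `L`. -/
def fromCycles (L : CochainComplex C ℤ) (p : ℤ) :
    (CochainComplex.singleFunctor C p).obj (L.cycles p) ⟶ L :=
  Cocycle.homOf (.fromSingleMk (L.iCycles p) (add_zero p) (p + 1) rfl (by simp))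

lemma ofHom_map_comp_fromCycles (L : CochainComplex C ℤ) (p : ℤ) {A : C} (a : A ⟶ L.cycles p) :
    Cochain.ofHom ((CochainComplex.singleFunctor C p).map a ≫ fromCycles L p) =
      Cochain.fromSingleMk (a ≫ L.iCycles p) (add_zero p) := by
  rw [Cochain.fromSingleMk_precomp, Cochain.ofHom_comp, fromCycles,
    Cocycle.cochain_ofHom_homOf_eq_coe, Cocycle.fromSingleMk_coe]

lemma exists_map_comp_fromCycles_eq {L : CochainComplex C ℤ} {p : ℤ} {A : C}
    (φ : (CochainComplex.singleFunctor C p).obj A ⟶ L) :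
    ∃ a : A ⟶ L.cycles p, (CochainComplex.singleFunctor C p).map a ≫ fromCycles L p = φ := by
  obtain ⟨f, hf, hφ⟩ := Cocycle.fromSingleMk_surjective
    (Cocycle.ofHom φ) p (add_zero p) (p + 1) rfl
  refine ⟨L.liftCycles f (p + 1) (by simp) hf,
    Cochain.ofHom_injective ?_⟩
  rw [ofHom_map_comp_fromCycles, L.liftCycles_i]
  exact congrArg Subtype.val hφ

lemma nonempty_homotopy_zero_iff {L : CochainComplex C ℤ} {p q : ℤ} (hqp : q + 1 = p) {A : C}
    (a : A ⟶ L.cycles p) :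
    Nonempty (Homotopy ((CochainComplex.singleFunctor C p).map a ≫ fromCycles L p) 0) ↔
      ∃ b : A ⟶ L.X q, b ≫ L.toCycles q p = a := by
  simp only [(Cochain.equivHomotopy _ _).nonempty_congr,
    nonempty_subtype, ofHom_map_comp_fromCycles, Cochain.ofHom_zero,
    add_zero]
  have δ_eq (b : A ⟶ L.X q) : δ (-1) 0
      (Cochain.fromSingleMk b (by lia : p + -1 = q)) =
      Cochain.fromSingleMk
        ((b ≫ L.toCycles q p) ≫ L.iCycles p) (add_zero p) := by
    rw [Cochain.δ_fromSingleMk _ _ _ p (add_zero p), Category.assoc,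
      L.toCycles_i]
  constructor
  · rintro ⟨z, hz⟩
    obtain ⟨b, rfl⟩ := Cochain.fromSingleMk_surjective z q (by lia)
    rw [δ_eq] at hz
    have := (Cochain.fromSingleEquiv (add_zero p)).symm.injective hz
    exact ⟨b, ((cancel_mono _).1 this).symm⟩
  · rintro ⟨b, rfl⟩
    exact ⟨_, (δ_eq b).symm⟩

variable [HasDerivedCategory.{w} C]

lemma Q_map_surjective_of_isKInjective (K L : CochainComplex C ℤ) [L.IsKInjective] :
    Function.Surjective (Q.map : (K ⟶ L) → (Q.obj K ⟶ Q.obj L)) :=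
  (CochainComplex.IsKInjective.Qh_map_bijective _ L).surjective.comp
    (HomotopyCategory.quotient _ _).map_surjective

lemma Q_map_eq_zero_iff_of_isKInjective {K L : CochainComplex C ℤ} [L.IsKInjective] (φ : K ⟶ L) :
    Q.map φ = 0 ↔ Nonempty (Homotopy φ 0) := by
  refine ⟨fun h => ⟨HomotopyCategory.homotopyOfEq _ _ ?_⟩, fun ⟨h⟩ => ?_⟩
  · refine (CochainComplex.IsKInjective.Qh_map_bijective _ L).injective ?_
    rw [Functor.map_zero, Functor.map_zero]
    exact h
  · have := HomotopyCategory.eq_of_homotopy _ _ h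
    rw [Functor.map_zero] at this
    exact (congrArg Qh.map this).trans (Qh.map_zero _ _)

/-- For every object `A`, the morphisms from the stalk of `A` in degree `p` to `Y` are the
cokernel of `Hom(A, B) ⟶ Hom(A, Z)`, by means of `d : B ⟶ Z` and of `q`. An injective resolution
`L` of `Y` provides such data, with `B = L.X (p - 1)` and `Z` the `p`-cycles of `L`. -/
structure PresentsStalkHom {p : ℤ} {Y : DerivedCategory C} {B Z : C} (d : B ⟶ Z)
    (q : (singleFunctor C p).obj Z ⟶ Y) : Prop where
  exists_eq : ∀ {A : C} (f : (singleFunctor C p).obj A ⟶ Y),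
    ∃ a : A ⟶ Z, (singleFunctor C p).map a ≫ q = f
  eq_zero_iff : ∀ {A : C} (a : A ⟶ Z),
    (singleFunctor C p).map a ≫ q = 0 ↔ ∃ b : A ⟶ B, b ≫ d = a

lemma PresentsStalkHom.comp_iso {p : ℤ} {Y Y' : DerivedCategory C} {B Z : C} {d : B ⟶ Z}
    {q : (singleFunctor C p).obj Z ⟶ Y} (h : PresentsStalkHom d q) (e : Y ≅ Y') :
    PresentsStalkHom d (q ≫ e.hom) where
  exists_eq f := (h.exists_eq (f ≫ e.inv)).imp fun a ha => by
    rw [← Category.assoc, ha, Category.assoc, e.inv_hom_id, Category.comp_id]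
  eq_zero_iff a := by rw [← h.eq_zero_iff, ← Category.assoc, Preadditive.IsIso.comp_right_eq_zero]

lemma presentsStalkHom_of_isKInjective (L : CochainComplex C ℤ) [L.IsKInjective] {p q : ℤ}
    (hqp : q + 1 = p) :
    PresentsStalkHom (p := p) (Y := Q.obj L) (L.toCycles q p) (Q.map (fromCycles L p)) where
  exists_eq f := by
    obtain ⟨φ, rfl⟩ := Q_map_surjective_of_isKInjective _ _ f
    obtain ⟨a, rfl⟩ := exists_map_comp_fromCycles_eq φ
    exact ⟨a, (Q.map_comp _ _).symm⟩
  eq_zero_iff a := by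
    rw [← nonempty_homotopy_zero_iff hqp, ← Q_map_eq_zero_iff_of_isKInjective, Q.map_comp]
    rfl

variable [EnoughInjectives C]

lemma exists_presentsStalkHom (p : ℤ) (Y : DerivedCategory C) (n : ℤ) [Y.IsGE n] :
    ∃ (B Z : C) (d : B ⟶ Z) (q : (singleFunctor C p).obj Z ⟶ Y), PresentsStalkHom d q := by
  obtain ⟨K, _, ⟨e⟩⟩ := DerivedCategory.exists_iso_Q_obj_of_isGE Y n
  obtain ⟨L, i, _, _, _⟩ := CochainComplex.Plus.modelCategoryQuillen.exists_quasiIso_injective K n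
  have := CochainComplex.isKInjective_of_injective L n
  exact ⟨_, _, _, _, (presentsStalkHom_of_isKInjective L (sub_add_cancel p 1)).comp_iso
    ((asIso (Q.map i)).symm ≪≫ e.symm)⟩

lemma small_hom_stalk (p : ℤ) (A : C) (Y : DerivedCategory C) (n : ℤ) [Y.IsGE n] :
    Small.{v} ((singleFunctor C p).obj A ⟶ Y) := by
  obtain ⟨_, _, _, _, h⟩ := exists_presentsStalkHom p Y n
  exact small_of_surjective fun f => h.exists_eq f

variable {I : Type t} {A : I → C} {c : Cofan A} (hc : IsColimit c)

include hc

lemma stalk_coproduct_hom_ext {p : ℤ} {Y : DerivedCategory C} (n : ℤ) [Y.IsGE n]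
    {f g : (singleFunctor C p).obj c.pt ⟶ Y}
    (hfg : ∀ i, (singleFunctor C p).map (c.inj i) ≫ f = (singleFunctor C p).map (c.inj i) ≫ g) :
    f = g := by
  obtain ⟨B, _, d, _, h⟩ := exists_presentsStalkHom p Y n
  obtain ⟨a, ha⟩ := h.exists_eq (f - g)
  have exists_lift (i : I) : ∃ r : A i ⟶ B, r ≫ d = c.inj i ≫ a := by
    rw [← h.eq_zero_iff, Functor.map_comp, Category.assoc, ha, Preadditive.comp_sub, hfg, sub_self]
  choose r hr using exists_lift
  rw [← sub_eq_zero, ← ha, h.eq_zero_iff]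
  exact ⟨Cofan.IsColimit.desc hc r, Cofan.IsColimit.hom_ext hc _ _ fun i => by simp [hr]⟩

lemma exists_stalk_coproduct_desc {p : ℤ} {Y : DerivedCategory C} (n : ℤ) [Y.IsGE n]
    (f : ∀ i, (singleFunctor C p).obj (A i) ⟶ Y) :
    ∃ g : (singleFunctor C p).obj c.pt ⟶ Y, ∀ i, (singleFunctor C p).map (c.inj i) ≫ g = f i := by
  obtain ⟨_, _, _, q, h⟩ := exists_presentsStalkHom p Y n
  choose a ha using fun i => h.exists_eq (f i)
  refine ⟨(singleFunctor C p).map (Cofan.IsColimit.desc hc a) ≫ q, fun i => ?_⟩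
  rw [← ha i, ← Category.assoc, ← Functor.map_comp, Cofan.IsColimit.fac]

end Resolution

section TorsionPair

variable {C : Type u} [Category.{v} C] [Abelian C] {T F : ObjectProperty C}

namespace IsTorsionPair

variable (h : IsTorsionPair T F)
include h

lemma torsion_of_hom_eq_zero [T.IsClosedUnderIsomorphisms] {X : C}
    (hX : ∀ Y, F Y → ∀ f : X ⟶ Y, f = 0) : T X := by
  obtain ⟨A, B, hA, hB, i, p, _, hS⟩ := h.exists_shortExact X
  have : Mono i := hS.mono_f
  have : Epi i := hS.exact.epi_f (hX B hB p)
  have := isIso_of_mono_of_epi i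
  exact T.prop_of_iso (asIso i) hA

lemma torsionFree_of_hom_eq_zero [F.IsClosedUnderIsomorphisms] {Y : C}
    (hY : ∀ X, T X → ∀ f : X ⟶ Y, f = 0) : F Y := by
  obtain ⟨A, B, hA, hB, i, p, _, hS⟩ := h.exists_shortExact Y
  have : Epi p := hS.epi_g
  have : Mono p := hS.exact.mono_g (hY A hA i)
  have := isIso_of_mono_of_epi p
  exact F.prop_of_iso (asIso p).symm hB

lemma torsion_of_epi [T.IsClosedUnderIsomorphisms] {X Y : C} (f : X ⟶ Y) [Epi f] (hX : T X) :
    T Y :=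
  h.torsion_of_hom_eq_zero fun Z hZ g => by
    rw [← cancel_epi f, comp_zero]
    exact h.hom_eq_zero hX hZ _

lemma torsionFree_of_mono [F.IsClosedUnderIsomorphisms] {X Y : C} (f : X ⟶ Y) [Mono f]
    (hY : F Y) : F X :=
  h.torsionFree_of_hom_eq_zero fun Z hZ g => by
    rw [← cancel_mono f, zero_comp]
    exact h.hom_eq_zero hZ hY _

lemma torsion_of_exact [T.IsClosedUnderIsomorphisms] {S : ShortComplex C} (hS : S.Exact)
    [Epi S.g] (h₁ : T S.X₁) (h₃ : T S.X₃) : T S.X₂ :=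
  h.torsion_of_hom_eq_zero fun Z hZ f => by
    obtain ⟨g, rfl⟩ := hS.desc' f (h.hom_eq_zero h₁ hZ _)
    rw [h.hom_eq_zero h₃ hZ g, comp_zero]

lemma torsionFree_of_exact [F.IsClosedUnderIsomorphisms] {S : ShortComplex C} (hS : S.Exact)
    [Mono S.f] (h₁ : F S.X₁) (h₃ : F S.X₃) : F S.X₂ :=
  h.torsionFree_of_hom_eq_zero fun Z hZ f => by
    obtain ⟨g, rfl⟩ := hS.lift' f (h.hom_eq_zero hZ h₃ _)
    rw [h.hom_eq_zero hZ h₁ g, zero_comp]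

lemma torsion_of_isZero [T.IsClosedUnderIsomorphisms] {X : C} (hX : IsZero X) : T X :=
  h.torsion_of_hom_eq_zero fun _ _ _ => hX.eq_of_src _ _

lemma torsionFree_of_isZero [F.IsClosedUnderIsomorphisms] {X : C} (hX : IsZero X) : F X :=
  h.torsionFree_of_hom_eq_zero fun _ _ _ => hX.eq_of_tgt _ _

end IsTorsionPair

end TorsionPair

section Pretriangulated

variable {D : Type*} [Category* D] [HasZeroObject D] [HasShift D ℤ] [Preadditive D]
  [∀ n : ℤ, (shiftFunctor D n).Additive] [Pretriangulated D]

lemma distinguished_of_iso {X Y Z X' Y' Z' : D} {f : X ⟶ Y} {g : Y ⟶ Z} {δ : Z ⟶ X⟦(1 : ℤ)⟧}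
    (hT : Triangle.mk f g δ ∈ distTriang D) (e₁ : X' ≅ X) (e₂ : Y' ≅ Y) (e₃ : Z' ≅ Z)
    {f' : X' ⟶ Y'} {g' : Y' ⟶ Z'} (hf : f' = e₁.hom ≫ f ≫ e₂.inv)
    (hg : g' = e₂.hom ≫ g ≫ e₃.inv) :
    Triangle.mk f' g' (e₃.hom ≫ δ ≫ e₁.inv⟦(1 : ℤ)⟧') ∈ distTriang D := by
  have h₁ : f' ≫ e₂.hom = e₁.hom ≫ f := by simp [hf]
  have h₂ : g' ≫ e₃.hom = e₂.hom ≫ g := by simp [hg]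
  have h₃ : (e₃.hom ≫ δ ≫ e₁.inv⟦(1 : ℤ)⟧') ≫ e₁.hom⟦(1 : ℤ)⟧' = e₃.hom ≫ δ := by
    simp [← Functor.map_comp]
  exact isomorphic_distinguished _ hT _ (Triangle.isoMk _ _ e₁ e₂ e₃ h₁ h₂ h₃)

-- The exactness properties of `Hom` are restated for `Triangle.mk f g δ`, since the projections of
-- `Triangle.mk` which appear in the general statements are not unfolded by `rw`.
section Exactness

variable {X Y Z W : D} {f : X ⟶ Y} {g : Y ⟶ Z} {δ : Z ⟶ X⟦(1 : ℤ)⟧}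
  (hT : Triangle.mk f g δ ∈ distTriang D)
include hT

lemma exists_desc_of_triangle₂ (k : Y ⟶ W) (hk : f ≫ k = 0) : ∃ l : Z ⟶ W, k = g ≫ l :=
  Triangle.yoneda_exact₂ _ hT k hk

lemma exists_desc_of_triangle₃ (k : Z ⟶ W) (hk : g ≫ k = 0) :
    ∃ l : X⟦(1 : ℤ)⟧ ⟶ W, k = δ ≫ l :=
  Triangle.yoneda_exact₃ _ hT k hk

lemma exists_lift_of_triangle₂ (k : W ⟶ Y) (hk : k ≫ g = 0) : ∃ l : W ⟶ X, k = l ≫ f :=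
  Triangle.coyoneda_exact₂ _ hT k hk

lemma exists_lift_of_triangle₃ (k : W ⟶ Z) (hk : k ≫ δ = 0) : ∃ l : W ⟶ Y, k = l ≫ g :=
  Triangle.coyoneda_exact₃ _ hT k hk

end Exactness

end Pretriangulated

section Truncation

variable {C : Type u} [Category.{v} C] [Abelian C] [HasDerivedCategory.{w} C]

section Triangle

variable {X Y Z : DerivedCategory C} {f : X ⟶ Y} {g : Y ⟶ Z} {δ : Z ⟶ X⟦(1 : ℤ)⟧}
  (hT : Triangle.mk f g δ ∈ distTriang _)
include hT

lemma mono_homology_map₂ (n : ℤ) (hX : IsZero ((homologyFunctor C n).obj X)) :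
    Mono ((homologyFunctor C n).map g) :=
  (HomologySequence.exact₂ _ hT n).mono_g (hX.eq_of_src _ _)

lemma epi_homology_map₂ (n m : ℤ) (hnm : n + 1 = m) (hX : IsZero ((homologyFunctor C m).obj X)) :
    Epi ((homologyFunctor C n).map g) :=
  (HomologySequence.exact₃ _ hT n m hnm).epi_f (hX.eq_of_tgt _ _)

lemma mono_homology_map₁ (n m : ℤ) (hnm : n + 1 = m) (hZ : IsZero ((homologyFunctor C n).obj Z)) :
    Mono ((homologyFunctor C m).map f) :=
  (HomologySequence.exact₁ _ hT n m hnm).mono_g (hZ.eq_of_src _ _)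

lemma epi_homology_map₁ (n : ℤ) (hZ : IsZero ((homologyFunctor C n).obj Z)) :
    Epi ((homologyFunctor C n).map f) :=
  (HomologySequence.exact₂ _ hT n).epi_f (hZ.eq_of_tgt _ _)

lemma exists_mono_homology₃ (n m : ℤ) (hnm : n + 1 = m)
    (hY : IsZero ((homologyFunctor C n).obj Y)) :
    ∃ (d : (homologyFunctor C n).obj Z ⟶ (homologyFunctor C m).obj X)
      (w : d ≫ (homologyFunctor C m).map f = 0), Mono d ∧ (ShortComplex.mk _ _ w).Exact :=
  ⟨_, _, (HomologySequence.exact₃ _ hT n m hnm).mono_g (hY.eq_of_src _ _),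
    HomologySequence.exact₁ _ hT n m hnm⟩

lemma isLE_of_triangle₃ (n m : ℤ) (hnm : n + 1 = m) [hX : X.IsLE m] [hY : Y.IsLE n] :
    Z.IsLE n := by
  rw [isLE_iff] at hX hY ⊢
  intro i hi
  exact (HomologySequence.exact₃ _ hT i (i + 1) rfl).isZero_of_both_isZero (hY i hi)
    (hX (i + 1) (by lia))

lemma isGE_of_triangle₃ (n m : ℤ) (hnm : n + 1 = m) [hX : X.IsGE m] [hY : Y.IsGE n] :
    Z.IsGE n := by
  rw [isGE_iff] at hX hY ⊢
  intro i hi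
  exact (HomologySequence.exact₃ _ hT i (i + 1) rfl).isZero_of_both_isZero (hY i hi)
    (hX (i + 1) (by lia))

lemma isGE_of_triangle₁ (n m : ℤ) (hnm : n + 1 = m) [hY : Y.IsGE m] [hZ : Z.IsGE n] :
    X.IsGE m := by
  rw [isGE_iff] at hY hZ ⊢
  intro i hi
  exact (HomologySequence.exact₁ _ hT (i - 1) i (by simp)).isZero_of_both_isZero
    (hZ _ (by lia)) (hY i hi)

end Triangle

/-- The identification of the homology of a stalk complex in its degree with the object placed
there. -/
def homologyStalkIso (n : ℤ) (A : C) :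
    (homologyFunctor C n).obj ((singleFunctor C n).obj A) ≅ A :=
  (singleFunctorCompHomologyFunctorIso C n).app A

lemma homologyStalkIso_hom_naturality (n : ℤ) {A B : C} (a : A ⟶ B) :
    (homologyFunctor C n).map ((singleFunctor C n).map a) ≫ (homologyStalkIso n B).hom =
      (homologyStalkIso n A).hom ≫ a :=
  (singleFunctorCompHomologyFunctorIso C n).hom.naturality a

/-- The identification of the homology of `X⟦a⟧` in degree `n` with the homology of `X` in
degree `a + n`. -/
def homologyShiftIso (X : DerivedCategory C) (a n m : ℤ) (h : a + n = m) :
    (homologyFunctor C n).obj (X⟦a⟧) ≅ (homologyFunctor C m).obj X :=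
  ((homologyFunctor C 0).shiftIso a n m h).app X

lemma isZero_homology_stalk (n m : ℤ) (h : m ≠ n) (A : C) :
    IsZero ((homologyFunctor C m).obj ((singleFunctor C n).obj A)) := by
  rcases lt_or_gt_of_ne h with h | h
  · exact isZero_of_isGE _ n m h
  · exact isZero_of_isLE _ n m h

lemma nonempty_iso_stalk_homology (X : DerivedCategory C) (n : ℤ) [X.IsGE n] [X.IsLE n] :
    Nonempty (X ≅ (singleFunctor C n).obj ((homologyFunctor C n).obj X)) := by
  obtain ⟨A, ⟨e⟩⟩ := exists_iso_singleFunctor_obj_of_isGE_of_isLE X n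
  exact ⟨e ≪≫ (singleFunctor C n).mapIso
    ((homologyFunctor C n).mapIso e ≪≫ homologyStalkIso n A).symm⟩

lemma exists_stalk_truncation_le (X : DerivedCategory C) (n m : ℤ) (hmn : m + 1 = n) [X.IsLE n] :
    ∃ (X' : DerivedCategory C) (i : X' ⟶ X)
      (p : X ⟶ (singleFunctor C n).obj ((homologyFunctor C n).obj X)) (δ : _ ⟶ X'⟦(1 : ℤ)⟧),
      Triangle.mk i p δ ∈ distTriang _ ∧ X'.IsLE m ∧ IsIso ((homologyFunctor C n).map p) := by
  obtain ⟨X', Y, hX', hY, i, p, δ, hT⟩ := TStructure.t.exists_triangle X m n hmn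
  have : X'.IsLE m := ⟨hX'⟩
  have : Y.IsGE n := ⟨hY⟩
  have : X'.IsLE (n + 1) := TStructure.t.isLE_of_le _ m _ (by lia)
  have : Y.IsLE n := isLE_of_triangle₃ hT n _ rfl
  have := mono_homology_map₂ hT n (isZero_of_isLE X' m n (by lia))
  have := epi_homology_map₂ hT n _ rfl (isZero_of_isLE X' m (n + 1) (by lia))
  have := isIso_of_mono_of_epi ((homologyFunctor C n).map p)
  obtain ⟨e⟩ := nonempty_iso_stalk_homology Y n
  let e' := e ≪≫ (singleFunctor C n).mapIso (asIso ((homologyFunctor C n).map p)).symm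
  refine ⟨X', i, p ≫ e'.hom, _, distinguished_of_iso hT (Iso.refl _) (Iso.refl _) e'.symm
    (by simp) (by simp), inferInstance, ?_⟩
  rw [Functor.map_comp]
  infer_instance

lemma exists_stalk_truncation_ge (Y : DerivedCategory C) (n m : ℤ) (hnm : n + 1 = m) [Y.IsGE n] :
    ∃ (Y' : DerivedCategory C) (i : (singleFunctor C n).obj ((homologyFunctor C n).obj Y) ⟶ Y)
      (p : Y ⟶ Y') (δ : Y' ⟶ _), Triangle.mk i p δ ∈ distTriang _ ∧ Y'.IsGE m := by
  obtain ⟨X, Y', hX, hY', i, p, δ, hT⟩ := TStructure.t.exists_triangle Y n m hnm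
  have : X.IsLE n := ⟨hX⟩
  have : Y'.IsGE m := ⟨hY'⟩
  have : Y'.IsGE (n - 1) := TStructure.t.isGE_of_ge _ _ m (by lia)
  have : X.IsGE n := isGE_of_triangle₁ hT (n - 1) n (by simp)
  have := mono_homology_map₁ hT (n - 1) n (by simp) (isZero_of_isGE Y' m (n - 1) (by lia))
  have := epi_homology_map₁ hT n (isZero_of_isGE Y' m n (by lia))
  have := isIso_of_mono_of_epi ((homologyFunctor C n).map i)
  obtain ⟨e⟩ := nonempty_iso_stalk_homology X n
  let e' := e ≪≫ (singleFunctor C n).mapIso (asIso ((homologyFunctor C n).map i))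
  exact ⟨Y', e'.inv ≫ i, p, _, distinguished_of_iso hT e'.symm (Iso.refl _) (Iso.refl _)
    (by simp) (by simp), inferInstance⟩

lemma exists_stalk_homology_triangle (X : DerivedCategory C) (n m : ℤ) (hnm : n + 1 = m)
    [X.IsGE n] [X.IsLE m] :
    ∃ (i : (singleFunctor C n).obj ((homologyFunctor C n).obj X) ⟶ X)
      (p : X ⟶ (singleFunctor C m).obj ((homologyFunctor C m).obj X)) (δ : _ ⟶ _),
      Triangle.mk i p δ ∈ distTriang _ := by
  obtain ⟨X', i, p, δ, hT, _⟩ := exists_stalk_truncation_ge X n m hnm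
  have : ((singleFunctor C n).obj ((homologyFunctor C n).obj X)).IsLE (m + 1) :=
    TStructure.t.isLE_of_le _ n _ (by lia)
  have : X'.IsLE m := isLE_of_triangle₃ hT m _ rfl
  have := mono_homology_map₂ hT m (isZero_homology_stalk n m (by lia) _)
  have := epi_homology_map₂ hT m _ rfl (isZero_homology_stalk n (m + 1) (by lia) _)
  have := isIso_of_mono_of_epi ((homologyFunctor C m).map p)
  obtain ⟨e⟩ := nonempty_iso_stalk_homology X' m
  let e' := e ≪≫ (singleFunctor C m).mapIso (asIso ((homologyFunctor C m).map p)).symm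
  exact ⟨i, p ≫ e'.hom, _, distinguished_of_iso hT (Iso.refl _) (Iso.refl _) e'.symm
    (by simp) (by simp)⟩

lemma eq_zero_of_comp_stalk_map_eq_zero {X : DerivedCategory C} {n : ℤ} {N B : C}
    (p : X ⟶ (singleFunctor C n).obj N) [Epi ((homologyFunctor C n).map p)] (b : N ⟶ B)
    (hpb : p ≫ (singleFunctor C n).map b = 0) : b = 0 := by
  have map_b_eq_zero : (homologyFunctor C n).map ((singleFunctor C n).map b) = 0 := by
    rw [← cancel_epi ((homologyFunctor C n).map p), ← Functor.map_comp, hpb, Functor.map_zero,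
      comp_zero]
  rw [← cancel_epi (homologyStalkIso n N).hom, ← homologyStalkIso_hom_naturality, map_b_eq_zero,
    zero_comp, comp_zero]

end Truncation

section Heart

variable {C : Type u} [Category.{v} C] [Abelian C] [HasDerivedCategory.{w} C]

/-- The identification of the shift of the stalk of `A` in degree `n` with the stalk of `A` in
degree `n - 1`. -/
def stalkShiftIso (n m : ℤ) (h : 1 + m = n) (A : C) :
    ((singleFunctor C n).obj A)⟦(1 : ℤ)⟧ ≅ (singleFunctor C m).obj A :=
  ((singleFunctors C).shiftIso 1 m n h).app A

/-- The shift `{X ∈ D^{≤ -1} | H^{-1}(X) ∈ T}` of the aisle of `T`. -/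
def shiftedAisle (T : ObjectProperty C) : ObjectProperty (DerivedCategory C) := fun X =>
  X.IsLE (-1) ∧ T ((homologyFunctor C (-1)).obj X)

variable {T F : ObjectProperty C} [T.IsClosedUnderIsomorphisms] [F.IsClosedUnderIsomorphisms]

lemma shiftedAisle_shift {X : DerivedCategory C} (hX : aisle T X) :
    shiftedAisle T (X⟦(1 : ℤ)⟧) := by
  have := hX.1
  exact ⟨TStructure.t.isLE_shift X 0 1 (-1), T.prop_of_iso
    (homologyShiftIso X 1 (-1) 0 (by simp)).symm hX.2⟩

lemma aisle_stalk {A : C} (hA : T A) : aisle T ((singleFunctor C 0).obj A) :=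
  ⟨inferInstance, T.prop_of_iso (homologyStalkIso 0 A).symm hA⟩

instance : (aisle T : ObjectProperty (DerivedCategory C)).IsClosedUnderIsomorphisms where
  of_iso e hX := by
    have := hX.1
    exact ⟨TStructure.t.isLE_of_iso e 0, T.prop_of_iso ((homologyFunctor C 0).mapIso e) hX.2⟩

instance : (coaisle F : ObjectProperty (DerivedCategory C)).IsClosedUnderIsomorphisms where
  of_iso e hX := by
    have := hX.1
    exact ⟨TStructure.t.isGE_of_iso e (-1), F.prop_of_iso ((homologyFunctor C (-1)).mapIso e) hX.2⟩

instance : (heart T F : ObjectProperty (DerivedCategory C)).IsClosedUnderIsomorphisms where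
  of_iso e hX := ⟨(aisle T).prop_of_iso e hX.1, (coaisle F).prop_of_iso e hX.2⟩

omit [T.IsClosedUnderIsomorphisms] [F.IsClosedUnderIsomorphisms] in
lemma exists_heart_triangle {X : DerivedCategory C} (hX : heart T F X) :
    ∃ (B A : C) (_ : F B) (_ : T A) (i : (singleFunctor C (-1)).obj B ⟶ X)
      (p : X ⟶ (singleFunctor C 0).obj A)
      (δ : (singleFunctor C 0).obj A ⟶ ((singleFunctor C (-1)).obj B)⟦(1 : ℤ)⟧),
      Triangle.mk i p δ ∈ distTriang _ := by
  obtain ⟨⟨_, hT⟩, ⟨_, hF⟩⟩ := hX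
  exact ⟨_, _, hF, hT, exists_stalk_homology_triangle X (-1) 0 (by simp)⟩

namespace IsTorsionPair

variable (h : IsTorsionPair T F)
include h

omit [T.IsClosedUnderIsomorphisms] [F.IsClosedUnderIsomorphisms] in
lemma hom_eq_zero_of_shiftedAisle {X Y : DerivedCategory C} (hX : shiftedAisle T X)
    (hY : coaisle F Y) (f : X ⟶ Y) : f = 0 := by
  obtain ⟨_, hX⟩ := hX
  obtain ⟨_, hY⟩ := hY
  obtain ⟨_, i, p, δ, hXT, _, _⟩ := exists_stalk_truncation_le X (-1) (-2) (by simp)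
  obtain ⟨_, j, q, ε, hYT, _⟩ := exists_stalk_truncation_ge Y (-1) 0 (by simp)
  obtain ⟨g, rfl⟩ := exists_desc_of_triangle₂ hXT f (TStructure.t.zero _ (-2) (-1))
  obtain ⟨k, rfl⟩ := exists_lift_of_triangle₂ hYT g (TStructure.t.zero _ (-1) 0)
  obtain ⟨k, rfl⟩ := (singleFunctor C (-1)).map_surjective k
  rw [h.hom_eq_zero hX hY k, Functor.map_zero, zero_comp, comp_zero]

lemma heart_stalk {A : C} (hA : T A) : heart T F ((singleFunctor C 0).obj A) :=
  ⟨aisle_stalk hA, TStructure.t.isGE_of_ge _ (-1) 0,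
    h.torsionFree_of_isZero (isZero_homology_stalk _ _ (by simp) _)⟩

lemma heart_stalk_shift {B : C} (hB : F B) : heart T F ((singleFunctor C (-1)).obj B) :=
  ⟨⟨TStructure.t.isLE_of_le _ (-1) 0,
    h.torsion_of_isZero (isZero_homology_stalk _ _ (by simp) _)⟩, inferInstance,
    F.prop_of_iso (homologyStalkIso (-1) B).symm hB⟩

variable {X Y Z : DerivedCategory C} {f : X ⟶ Y} {g : Y ⟶ Z} {δ : Z ⟶ X⟦(1 : ℤ)⟧}

lemma heart_of_triangle₂ (hT : Triangle.mk f g δ ∈ distTriang _) (hX : heart T F X)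
    (hZ : heart T F Z) : heart T F Y := by
  obtain ⟨⟨_, hX0⟩, ⟨_, hX1⟩⟩ := hX
  obtain ⟨⟨_, hZ0⟩, ⟨_, hZ1⟩⟩ := hZ
  have := epi_homology_map₂ hT 0 1 rfl (isZero_of_isLE X 0 1 (by simp))
  have := mono_homology_map₁ hT (-2) (-1) rfl (isZero_of_isGE Z (-1) (-2) (by simp))
  exact ⟨⟨TStructure.t.isLE₂ _ hT 0 ‹_› ‹_›,
      h.torsion_of_exact (S := .mk ((homologyFunctor C 0).map f) ((homologyFunctor C 0).map g) _)
        (HomologySequence.exact₂ _ hT 0) hX0 hZ0⟩,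
    ⟨TStructure.t.isGE₂ _ hT (-1) ‹_› ‹_›,
      h.torsionFree_of_exact
        (S := .mk ((homologyFunctor C (-1)).map f) ((homologyFunctor C (-1)).map g) _)
        (HomologySequence.exact₂ _ hT (-1)) hX1 hZ1⟩⟩

omit [T.IsClosedUnderIsomorphisms] [F.IsClosedUnderIsomorphisms] in
lemma eq_zero_of_comp_eq_zero (hT : Triangle.mk f g δ ∈ distTriang _) (hZ : shiftedAisle T Z)
    {W : DerivedCategory C} (hW : coaisle F W) (k : Y ⟶ W) (hk : f ≫ k = 0) : k = 0 := by
  obtain ⟨l, rfl⟩ := exists_desc_of_triangle₂ hT k hk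
  rw [h.hom_eq_zero_of_shiftedAisle hZ hW l, comp_zero]

/-- The truncations of `Z` and, for `b : H^{-1}(Z) ⟶ B` the torsion-free quotient, the composite
`Z ⟶ H^{-1}(Z)[1] ⟶ B[1]` are morphisms to objects of the heart. -/
lemma shiftedAisle_of_hom_eq_zero [Z.IsLE 0] (hZ : T ((homologyFunctor C 0).obj Z))
    (hom_eq_zero : ∀ W, heart T F W → ∀ k : Z ⟶ W, k = 0) : shiftedAisle T Z := by
  have isZero_homology_zero : IsZero ((homologyFunctor C 0).obj Z) := by
    obtain ⟨_, _, p, _, _, _, _⟩ := exists_stalk_truncation_le Z 0 (-1) (by simp)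
    rw [IsZero.iff_id_eq_zero, ← cancel_mono ((homologyFunctor C 0).map p),
      hom_eq_zero _ (h.heart_stalk hZ) p, Functor.map_zero, comp_zero, comp_zero]
  have : Z.IsLE (-1) := by
    rw [isLE_iff]
    intro i hi
    rcases (show 0 ≤ i by lia).eq_or_lt with rfl | hi
    · exact isZero_homology_zero
    · exact isZero_of_isLE Z 0 i hi
  obtain ⟨_, _, p, _, _, _, _⟩ := exists_stalk_truncation_le Z (-1) (-2) (by simp)
  obtain ⟨A, B, hA, hB, a, b, _, hS⟩ := h.exists_shortExact ((homologyFunctor C (-1)).obj Z)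
  have hb : b = 0 :=
    eq_zero_of_comp_stalk_map_eq_zero p b (hom_eq_zero _ (h.heart_stalk_shift hB) _)
  have : Epi a := hS.exact.epi_f hb
  exact ⟨inferInstance, h.torsion_of_epi a hA⟩

lemma shiftedAisle_of_epi (hT : Triangle.mk f g δ ∈ distTriang _) (hX : heart T F X)
    (hY : heart T F Y) (hf : ∀ W, heart T F W → ∀ k : Y ⟶ W, f ≫ k = 0 → k = 0) :
    shiftedAisle T Z := by
  obtain ⟨_, hY0⟩ := hY.1
  have hX_le : X.IsLE 0 := hX.1.1
  have : X.IsLE (0 + 1) := TStructure.t.isLE_of_le _ 0 _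
  have : Z.IsLE 0 := isLE_of_triangle₃ hT 0 _ rfl
  have := epi_homology_map₂ hT 0 1 rfl (isZero_of_isLE X 0 1 (by simp))
  refine h.shiftedAisle_of_hom_eq_zero (h.torsion_of_epi ((homologyFunctor C 0).map g) hY0)
    fun W hW k => ?_
  have f_g : f ≫ g = 0 := comp_distTriang_mor_zero₁₂ _ hT
  obtain ⟨l, rfl⟩ := exists_desc_of_triangle₃ hT k
    (hf W hW _ (by rw [← Category.assoc, f_g, zero_comp]))
  rw [h.hom_eq_zero_of_shiftedAisle (shiftedAisle_shift hX.1) hW.2 l, comp_zero]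

end IsTorsionPair

end Heart

section TiltingTorsionPair

lemma IsTorsionPair.torsion_coproduct {C : Type u} [Category.{v} C] [Abelian C]
    {T F : ObjectProperty C} [T.IsClosedUnderIsomorphisms] (h : IsTorsionPair T F)
    {I : Type t} {A : I → C} {c : Cofan A} (hc : IsColimit c) (hA : ∀ i, T (A i)) : T c.pt :=
  h.torsion_of_hom_eq_zero fun Y hY f => Cofan.IsColimit.hom_ext hc _ _ fun i => by
    rw [h.hom_eq_zero (hA i) hY (c.inj i ≫ f), comp_zero]

variable {C : Type u} [Category.{v} C] [Abelian C] [HasDerivedCategory.{w} C]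

/-- The conditions on a torsion pair `(T, F)` and an object `V` which make the stalk complex of `V`
a projective generator of the heart. The vanishing of `Ext^1(V, -)` on `T` and of `Ext^2(V, -)` on
`F` is expressed by morphisms in the derived category. -/
structure IsTiltingTorsionPair (T F : ObjectProperty C) (V : C) : Prop where
  torsionPair : IsTorsionPair T F
  self : T V
  presentation : ∀ X, T X → ∃ (I : Type v) (c : Cofan fun _ : I => V) (_ : IsColimit c) (K : C)
    (_ : T K) (i : K ⟶ c.pt) (p : c.pt ⟶ X) (w : i ≫ p = 0), (ShortComplex.mk i p w).ShortExact
  hom_shift_one : ∀ X, T X →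
    ∀ f : (singleFunctor C 0).obj V ⟶ (singleFunctor C (-1)).obj X, f = 0
  hom_shift_two : ∀ X, F X →
    ∀ f : (singleFunctor C 0).obj V ⟶ (singleFunctor C (-2)).obj X, f = 0
  embeds : ∀ X, F X → ∃ (Y : C) (_ : T Y) (i : X ⟶ Y), Mono i

variable {T F : ObjectProperty C}

lemma exists_triangle_of_shortExact {S : ShortComplex C} (hS : S.ShortExact) :
    ∃ (δ : (singleFunctor C 0).obj S.X₃ ⟶ (singleFunctor C (-1)).obj S.X₁)
      (ε : (singleFunctor C (-1)).obj S.X₁ ⟶ ((singleFunctor C 0).obj S.X₂)⟦(1 : ℤ)⟧),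
      Triangle.mk ((singleFunctor C 0).map S.g) δ ε ∈ distTriang _ := by
  have hT : Triangle.mk ((singleFunctor C 0).map S.f) ((singleFunctor C 0).map S.g) hS.singleδ ∈
      distTriang _ := hS.singleTriangle_distinguished
  have rotated : Triangle.mk ((singleFunctor C 0).map S.g) hS.singleδ _ ∈ distTriang _ :=
    rot_of_distTriang _ hT
  exact ⟨hS.singleδ ≫ (stalkShiftIso 0 (-1) (by simp) S.X₁).hom, _,
    distinguished_of_iso rotated (Iso.refl _) (Iso.refl _)
      (stalkShiftIso 0 (-1) (by simp) S.X₁).symm (by simp) (by simp)⟩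

lemma exists_stalk_coproduct_hom [EnoughInjectives C] [HasCoproducts.{v} C] (V : C) {J : Type v}
    {X : J → DerivedCategory C} {Y : DerivedCategory C} (n : ℤ) [∀ j, (X j).IsGE n] [Y.IsGE n]
    (ι : ∀ j, X j ⟶ Y) :
    ∃ (S : Type v) (d : Cofan fun _ : S => V) (_ : IsColimit d)
      (p : (singleFunctor C 0).obj d.pt ⟶ Y),
      (∀ s, ∃ j g, (singleFunctor C 0).map (d.inj s) ≫ p = g ≫ ι j) ∧
      ∀ j g, ∃ s, (singleFunctor C 0).map (d.inj s) ≫ p = g ≫ ι j := by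
  have (j : J) : Small.{v} ((singleFunctor C 0).obj V ⟶ X j) := small_hom_stalk 0 V _ n
  let S : Type v := Σ j, Shrink.{v} ((singleFunctor C 0).obj V ⟶ X j)
  let d : Cofan fun _ : S => V := Cofan.mk _ (Sigma.ι fun _ : S => V)
  have hd : IsColimit d := coproductIsCoproduct _
  obtain ⟨p, hp⟩ := exists_stalk_coproduct_desc hd n
    fun s : S => (equivShrink _).symm s.2 ≫ ι s.1
  exact ⟨S, d, hd, p, fun s => ⟨s.1, _, hp s⟩,
    fun j g => ⟨⟨j, equivShrink _ g⟩, by rw [hp, Equiv.symm_apply_apply]⟩⟩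

namespace IsTiltingTorsionPair

variable {V : C} (h : IsTiltingTorsionPair T F V)
include h

lemma exists_lift_stalk {X : DerivedCategory C} {A B : C} (hB : F B)
    {i : (singleFunctor C (-1)).obj B ⟶ X} {p : X ⟶ (singleFunctor C 0).obj A}
    {δ : (singleFunctor C 0).obj A ⟶ ((singleFunctor C (-1)).obj B)⟦(1 : ℤ)⟧}
    (hT : Triangle.mk i p δ ∈ distTriang _) (f : (singleFunctor C 0).obj V ⟶ _) :
    ∃ l, f = l ≫ p := by
  refine exists_lift_of_triangle₃ hT f ?_
  rw [← cancel_mono (stalkShiftIso (-1) (-2) (by simp) B).hom, zero_comp]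
  exact h.hom_shift_two B hB _

lemma hom_eq_zero_of_shiftedAisle {Z : DerivedCategory C} (hZ : shiftedAisle T Z) [Z.IsGE (-2)]
    (hF : F ((homologyFunctor C (-2)).obj Z)) (f : (singleFunctor C 0).obj V ⟶ Z) : f = 0 := by
  obtain ⟨_, hZ⟩ := hZ
  obtain ⟨i, p, δ, hT⟩ := exists_stalk_homology_triangle Z (-2) (-1) (by simp)
  obtain ⟨g, rfl⟩ := exists_lift_of_triangle₂ hT f (h.hom_shift_one _ hZ _)
  rw [h.hom_shift_two _ hF g, zero_comp]

variable [T.IsClosedUnderIsomorphisms] [F.IsClosedUnderIsomorphisms]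

lemma heart_self : heart T F ((singleFunctor C 0).obj V) := h.torsionPair.heart_stalk h.self

/-- The cone `Z` of a morphism `e` which is an epimorphism in the heart lies in the shifted aisle,
and `H^{-2}(Z)` embeds in `H^{-1}(X)`, so that `V[0] ⟶ Z` vanishes. -/
lemma exists_lift {X Y : DerivedCategory C} (hX : heart T F X) (hY : heart T F Y) (e : X ⟶ Y)
    (he : ∀ W, heart T F W → ∀ k : Y ⟶ W, e ≫ k = 0 → k = 0)
    (f : (singleFunctor C 0).obj V ⟶ Y) : ∃ g, f = g ≫ e := by
  obtain ⟨Z, g, δ, hT⟩ := distinguished_cocone_triangle e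
  have hZ := h.torsionPair.shiftedAisle_of_epi hT hX hY he
  obtain ⟨-, ⟨_, hX1⟩⟩ := hX
  obtain ⟨-, ⟨_, -⟩⟩ := hY
  have : X.IsGE (-2 + 1) := TStructure.t.isGE_of_ge _ _ (-1)
  have : Y.IsGE (-2) := TStructure.t.isGE_of_ge _ _ (-1)
  have : Z.IsGE (-2) := isGE_of_triangle₃ hT (-2) _ rfl
  obtain ⟨d, _, _, -⟩ := exists_mono_homology₃ hT (-2) (-1) rfl
    (isZero_of_isGE Y (-1) (-2) (by simp))
  have hF := h.torsionPair.torsionFree_of_mono d hX1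
  exact exists_lift_of_triangle₂ hT f (h.hom_eq_zero_of_shiftedAisle hZ hF _)

variable [EnoughInjectives C]

omit [F.IsClosedUnderIsomorphisms] in
lemma stalk_hom_eq_zero {A : C} (hA : T A) {Y : DerivedCategory C} (hY : coaisle F Y)
    (k : (singleFunctor C 0).obj A ⟶ Y)
    (hk : ∀ g : V ⟶ A, (singleFunctor C 0).map g ≫ k = 0) : k = 0 := by
  obtain ⟨I, c, hc, K, hK, i, p, w, hS⟩ := h.presentation A hA
  have := hY.1
  have map_p_comp_k : (singleFunctor C 0).map p ≫ k = 0 :=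
    stalk_coproduct_hom_ext hc (-1) fun j => by
      rw [← Category.assoc, ← Functor.map_comp, hk, comp_zero]
  exact h.torsionPair.eq_zero_of_comp_eq_zero
    (rot_of_distTriang _ hS.singleTriangle_distinguished)
    (shiftedAisle_shift (aisle_stalk hK)) hY k map_p_comp_k

omit [F.IsClosedUnderIsomorphisms] in
/-- For an embedding of `B` in a torsion object `A`, the connecting morphism
`(A / B)[0] ⟶ B[1]` has cone `A[1]`, which has no nonzero morphism to the co-aisle. -/
lemma stalk_shift_hom_eq_zero {B : C} (hB : F B) {Y : DerivedCategory C} (hY : coaisle F Y)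
    (k : (singleFunctor C (-1)).obj B ⟶ Y)
    (hk : ∀ g : (singleFunctor C 0).obj V ⟶ (singleFunctor C (-1)).obj B, g ≫ k = 0) : k = 0 := by
  obtain ⟨A, hA, i, _⟩ := h.embeds B hB
  have hS : (ShortComplex.mk i (cokernel.π i) (by simp)).ShortExact :=
    { exact := ShortComplex.exact_cokernel i }
  obtain ⟨δ, ε, hT⟩ := exists_triangle_of_shortExact hS
  have δ_comp_k : δ ≫ k = 0 :=
    h.stalk_hom_eq_zero (h.torsionPair.torsion_of_epi (cokernel.π i) hA) hY _ fun g => by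
      rw [← Category.assoc]
      exact hk _
  exact h.torsionPair.eq_zero_of_comp_eq_zero (rot_of_distTriang _ hT)
    (shiftedAisle_shift (aisle_stalk hA)) hY k δ_comp_k

omit [F.IsClosedUnderIsomorphisms] in
lemma hom_eq_zero {X Y : DerivedCategory C} (hX : heart T F X) (hY : coaisle F Y) (f : X ⟶ Y)
    (hf : ∀ g : (singleFunctor C 0).obj V ⟶ X, g ≫ f = 0) : f = 0 := by
  obtain ⟨B, A, hB, hA, i, p, δ, hT⟩ := exists_heart_triangle hX
  obtain ⟨k, rfl⟩ := exists_desc_of_triangle₂ hT f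
    (h.stalk_shift_hom_eq_zero hB hY _ fun g => by rw [← Category.assoc]; exact hf _)
  rw [h.stalk_hom_eq_zero hA hY k fun g => ?_, comp_zero]
  obtain ⟨l, hl⟩ := h.exists_lift_stalk hB hT ((singleFunctor C 0).map g)
  rw [hl, Category.assoc]
  exact hf l

variable [HasCoproducts.{v} C]

omit [F.IsClosedUnderIsomorphisms] in
lemma exists_stalk_coproduct_of_family {J : Type v} {X : J → DerivedCategory C}
    {Y : DerivedCategory C} (hX : ∀ j, heart T F (X j)) [Y.IsGE (-1)] (ι : ∀ j, X j ⟶ Y) :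
    ∃ (S : Type v) (d : Cofan fun _ : S => V) (_ : IsColimit d)
      (p : (singleFunctor C 0).obj d.pt ⟶ Y),
      (∀ s, ∃ j g, (singleFunctor C 0).map (d.inj s) ≫ p = g ≫ ι j) ∧
      ∀ W, coaisle F W → ∀ k : Y ⟶ W, p ≫ k = 0 → ∀ j, ι j ≫ k = 0 := by
  have (j : J) : (X j).IsGE (-1) := (hX j).2.1
  obtain ⟨S, d, hd, p, hp, exists_inj_comp_p⟩ := exists_stalk_coproduct_hom V (-1) ι
  refine ⟨S, d, hd, p, hp, fun W hW k hk j => h.hom_eq_zero (hX j) hW _ fun g => ?_⟩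
  obtain ⟨s, hs⟩ := exists_inj_comp_p j g
  rw [← Category.assoc, ← hs, Category.assoc, hk, comp_zero]

lemma exists_presentation {X : DerivedCategory C} (hX : heart T F X) :
    ∃ (I : Type v) (c : Cofan fun _ : I => V) (_ : IsColimit c) (M : C) (_ : T M)
      (a : M ⟶ c.pt) (p : (singleFunctor C 0).obj c.pt ⟶ X)
      (δ : X ⟶ ((singleFunctor C 0).obj M)⟦(1 : ℤ)⟧),
      Triangle.mk ((singleFunctor C 0).map a) p δ ∈ distTriang _ := by
  have := hX.2.1
  obtain ⟨I, c, hc, p, -, p_epi⟩ :=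
    h.exists_stalk_coproduct_of_family (fun _ : PUnit => hX) fun _ => 𝟙 X
  have hcT := h.torsionPair.torsion_coproduct hc fun _ => h.self
  obtain ⟨W, a, δ, hT⟩ := distinguished_cocone_triangle₁ p
  have hW := h.torsionPair.shiftedAisle_of_epi (rot_of_distTriang _ hT)
    (h.torsionPair.heart_stalk hcT) hX fun W hW k hk =>
      (Category.id_comp k).symm.trans (p_epi W hW.2 k hk ⟨⟩)
  have : W.IsLE 0 := by
    have : (W⟦(1 : ℤ)⟧).IsLE (-1) := hW.1
    exact TStructure.t.isLE_of_shift W 0 1 (-1)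
  have : W.IsGE 0 := isGE_of_triangle₁ hT (-1) 0 (by simp)
  obtain ⟨e⟩ := nonempty_iso_stalk_homology W 0
  obtain ⟨a', ha'⟩ := (singleFunctor C 0).map_surjective (e.inv ≫ a)
  exact ⟨I, c, hc, _, T.prop_of_iso (homologyShiftIso W 1 (-1) 0 (by simp)) hW.2, a', p, _,
    distinguished_of_iso hT e.symm (Iso.refl _) (Iso.refl _) (by simp [ha']) (by simp)⟩

end IsTiltingTorsionPair

end TiltingTorsionPair

section Compact

variable {C : Type u} [Category.{v} C] [Preadditive C]

@[simp]
lemma coproductComparison_of {P : C} {I : Type t} [hI : DecidableEq I] {X : I → C} (c : Cofan X)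
    (i : I) (f : P ⟶ X i) :
    coproductComparison P c (DirectSum.of (fun i => P ⟶ X i) i f) = f ≫ c.inj i := by
  obtain rfl : hI = fun a b => Classical.propDecidable (a = b) := Subsingleton.elim _ _
  classical
  exact DirectSum.toAddMonoid_of (fun i => Preadditive.rightComp P (c.inj i)) i f

/-- The projection of a coproduct `c.pt` of the family `X` onto `X j`. -/
def coproductProj {I : Type t} {X : I → C} {c : Cofan X} (hc : IsColimit c) (j : I) :
    c.pt ⟶ X j :=
  open scoped Classical in
  Cofan.IsColimit.desc hc fun i => if h : i = j then eqToHom (by rw [h]) else 0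

@[simp]
lemma inj_coproductProj_self {I : Type t} {X : I → C} {c : Cofan X} (hc : IsColimit c) (j : I) :
    c.inj j ≫ coproductProj hc j = 𝟙 _ := by simp [coproductProj]

lemma inj_coproductProj_of_ne {I : Type t} {X : I → C} {c : Cofan X} (hc : IsColimit c)
    {i j : I} (h : i ≠ j) : c.inj i ≫ coproductProj hc j = 0 := by simp [coproductProj, h]

lemma coproductComparison_comp_coproductProj (P : C) {I : Type t} {X : I → C} {c : Cofan X}
    (hc : IsColimit c) (x : ⨁ i, (P ⟶ X i)) (j : I) :
    coproductComparison P c x ≫ coproductProj hc j = x j := by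
  classical
  induction x using DirectSum.induction_on with
  | zero => simp
  | of i f =>
    rw [coproductComparison_of, Category.assoc]
    rcases eq_or_ne i j with rfl | hij
    · simp
    · rw [inj_coproductProj_of_ne hc hij, DirectSum.of_eq_of_ne _ _ _ hij.symm, comp_zero]
  | add y z hy hz =>
    rw [map_add, Preadditive.add_comp, hy, hz]
    rfl

lemma coproductComparison_injective (P : C) {I : Type t} {X : I → C} {c : Cofan X}
    (hc : IsColimit c) : Function.Injective (coproductComparison P c) := by
  rw [injective_iff_map_eq_zero]
  intro x hx
  ext j
  rw [← coproductComparison_comp_coproductProj P hc, hx, zero_comp]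
  rfl

lemma exists_finset_of_coproductComparison {P : C} {I : Type t} {X : I → C} (c : Cofan X)
    (x : ⨁ i, (P ⟶ X i)) : ∃ s : Finset I, ∀ (Z : C) (g : c.pt ⟶ Z),
      (∀ i ∈ s, c.inj i ≫ g = 0) → coproductComparison P c x ≫ g = 0 := by
  classical
  induction x using DirectSum.induction_on with
  | zero => exact ⟨∅, fun Z g _ => by simp⟩
  | of i f =>
    refine ⟨{i}, fun Z g hg => ?_⟩
    rw [coproductComparison_of, Category.assoc, hg i (by simp), comp_zero]
  | add x y hx hy =>
    obtain ⟨s, hs⟩ := hx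
    obtain ⟨s', hs'⟩ := hy
    refine ⟨s ∪ s', fun Z g hg => ?_⟩
    rw [map_add, Preadditive.add_comp, hs Z g fun i hi => hg i (by simp [hi]),
      hs' Z g fun i hi => hg i (by simp [hi]), add_zero]

lemma map_coproductComparison_mem_range {D : Type*} [Category* D] [Preadditive D] {V : C}
    {S : Type t} {Y : S → C} (d : Cofan Y) {P : D} {I : Type*} {X : I → D} (c : Cofan X)
    (φ : (V ⟶ d.pt) →+ (P ⟶ c.pt)) (hφ : ∀ s g, ∃ i f, φ (g ≫ d.inj s) = f ≫ c.inj i)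
    (x : ⨁ s, (V ⟶ Y s)) : φ (coproductComparison V d x) ∈ (coproductComparison P c).range := by
  classical
  induction x using DirectSum.induction_on with
  | zero =>
    rw [map_zero, map_zero]
    exact zero_mem _
  | of s g =>
    obtain ⟨i, f, hf⟩ := hφ s g
    exact ⟨DirectSum.of _ i f, by rw [coproductComparison_of, coproductComparison_of, hf]⟩
  | add x y hx hy =>
    rw [map_add, map_add]
    exact add_mem hx hy

end Compact

section Progenerator

variable {C : Type u} [Category.{v} C] [Abelian C] [HasDerivedCategory.{w} C]
  {T F : ObjectProperty C}

lemma eq_zero_of_epi_of_comp_eq_zero {X Y : (heart T F).FullSubcategory} (e : X ⟶ Y) [Epi e]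
    {W : DerivedCategory C} (hW : heart T F W) (k : Y.obj ⟶ W) (hk : e.hom ≫ k = 0) : k = 0 := by
  have comp_homMk_k : e ≫ (ObjectProperty.homMk k : Y ⟶ ⟨W, hW⟩) = 0 := by
    ext
    exact hk
  exact congr_arg (fun l => l.hom) ((cancel_epi e).1 (comp_homMk_k.trans comp_zero.symm))

namespace IsTiltingTorsionPair

variable [T.IsClosedUnderIsomorphisms] [F.IsClosedUnderIsomorphisms] {V : C}
  (h : IsTiltingTorsionPair T F V)
include h

lemma projective_stalk : Projective (⟨_, h.heart_self⟩ : (heart T F).FullSubcategory) :=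
  ⟨fun {E X} f e _ => by
    obtain ⟨g, hg⟩ := h.exists_lift E.property X.property e.hom
      (fun _ hW => eq_zero_of_epi_of_comp_eq_zero e hW) f.hom
    exact ⟨ObjectProperty.homMk g, by ext; exact hg.symm⟩⟩

variable [EnoughInjectives C]

lemma isSeparator_stalk : IsSeparator (⟨_, h.heart_self⟩ : (heart T F).FullSubcategory) := by
  rw [Preadditive.isSeparator_iff]
  intro X Y f hf
  ext
  exact h.hom_eq_zero X.property Y.property.2 f.hom fun g =>
    congr_arg (fun l => l.hom) (hf (ObjectProperty.homMk g))

variable [HasCoproducts.{v} C]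

/-- A coproduct `⨁ X i` of the heart is a quotient of `V^(S)[0]` for some set `S`, with each
component `V[0] ⟶ ⨁ X i` factoring through some `X i`. Hence a morphism `V[0] ⟶ ⨁ X i` lifts to
`V ⟶ V^(S)`, which comes from finitely many components because `V` is self-small. -/
lemma isCompactObject_stalk (hV : IsSelfSmall V) :
    IsCompactObject.{v} (⟨_, h.heart_self⟩ : (heart T F).FullSubcategory) := by
  refine fun I X c hc => ⟨coproductComparison_injective _ hc, fun f => ?_⟩
  have := c.pt.property.2.1
  obtain ⟨S, d, hd, p, hp, p_epi⟩ := h.exists_stalk_coproduct_of_family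
    (fun i => (X i).property) fun i => (c.inj i).hom
  have hdT := h.torsionPair.torsion_coproduct hd fun _ => h.self
  have p_epi (W) (hW : heart T F W) (k : c.pt.obj ⟶ W) (hk : p ≫ k = 0) : k = 0 := by
    have homMk_k : (ObjectProperty.homMk k : c.pt ⟶ ⟨W, hW⟩) = 0 :=
      Cofan.IsColimit.hom_ext hc _ _ fun i => by
        ext
        rw [comp_zero]
        exact p_epi W hW.2 k hk i
    exact congr_arg (fun l => l.hom) homMk_k
  obtain ⟨l, hl⟩ := h.exists_lift (h.torsionPair.heart_stalk hdT) c.pt.property p p_epi f.hom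
  obtain ⟨m, rfl⟩ := (singleFunctor C 0).map_surjective l
  obtain ⟨x, rfl⟩ := (hV S d hd).2 m
  let φ : (V ⟶ d.pt) →+ ((⟨_, h.heart_self⟩ : (heart T F).FullSubcategory) ⟶ c.pt) :=
    { toFun m := ObjectProperty.homMk ((singleFunctor C 0).map m ≫ p)
      map_zero' := by
        ext
        simp
      map_add' a b := by
        ext
        rw [Functor.map_add, Preadditive.add_comp]
        rfl }
  have φ_apply : f = φ (coproductComparison V d x) := by
    ext
    exact hl
  rw [φ_apply]
  refine map_coproductComparison_mem_range d c φ (fun s g => ?_) x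
  obtain ⟨i, q, hq⟩ := hp s
  refine ⟨i, ObjectProperty.homMk ((singleFunctor C 0).map g ≫ q), ?_⟩
  ext
  simp [φ, hq]

theorem isProgenerator (hV : IsSelfSmall V) :
    IsProgenerator.{v} (⟨_, h.heart_self⟩ : (heart T F).FullSubcategory) where
  projective := h.projective_stalk
  compact := h.isCompactObject_stalk hV
  generator := h.isSeparator_stalk

end IsTiltingTorsionPair

end Progenerator

section Ext

variable {C : Type u} [Category.{v} C] [Abelian C] {V : C}

lemma kerExt_iff_ext (n : ℕ) (X : C) :
    kerExt n V X ↔ haveI := HasExt.standard C; ∀ x : Abelian.Ext.{max u v} V X n, x = 0 := by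
  have := HasExt.standard C
  exact ⟨fun _ x => Subsingleton.elim (h := by assumption) _ _,
    fun h => ⟨fun x y => by rw [h x, h y]⟩⟩

lemma kerExt_iff_hom [HasDerivedCategory.{w} C] (n : ℕ) (m : ℤ) (h : n + m = 0) (X : C) :
    kerExt n V X ↔ ∀ f : (singleFunctor C 0).obj V ⟶ (singleFunctor C m).obj X, f = 0 := by
  have := HasExt.standard C
  let e := ((singleFunctors C).shiftIso (n : ℤ) m 0 h).app X
  let φ : Abelian.Ext.{max u v} V X n ≃ ((singleFunctor C 0).obj V ⟶ (singleFunctor C m).obj X) :=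
    Abelian.Ext.homAddEquiv.{w, max u v}.toEquiv.trans (Iso.homToEquiv e)
  have φ_zero : φ 0 = 0 :=
    (congrArg (· ≫ e.hom) (map_zero Abelian.Ext.homAddEquiv)).trans zero_comp
  rw [kerExt_iff_ext, ← φ.forall_congr_right]
  simp only [← φ_zero, φ.apply_eq_iff_eq]

lemma kerExt_of_injective (n : ℕ) (X : C) [Injective X] : kerExt (n + 1) V X := by
  have := HasExt.standard C
  exact Abelian.Ext.subsingleton_of_injective V X n

variable {S : ShortComplex C} (hS : S.ShortExact)
include hS

lemma exists_lift_of_kerExt_one (h : kerExt 1 V S.X₁) (f : V ⟶ S.X₃) :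
    ∃ g : V ⟶ S.X₂, g ≫ S.g = f := by
  have := HasExt.standard C
  rw [kerExt_iff_ext] at h
  obtain ⟨x, hx⟩ := Abelian.Ext.covariant_sequence_exact₃ V hS (Abelian.Ext.mk₀ f) rfl (h _)
  obtain ⟨g, rfl⟩ := (Abelian.Ext.mk₀_bijective _ _).2 x
  refine ⟨g, (Abelian.Ext.mk₀_bijective _ _).1 ?_⟩
  rw [← hx, Abelian.Ext.mk₀_comp_mk₀]

lemma kerExt_one_of_exists_lift (h₂ : kerExt 1 V S.X₂)
    (h : ∀ f : V ⟶ S.X₃, ∃ g : V ⟶ S.X₂, g ≫ S.g = f) : kerExt 1 V S.X₁ := by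
  have := HasExt.standard C
  rw [kerExt_iff_ext] at h₂ ⊢
  intro x
  obtain ⟨y, rfl⟩ := Abelian.Ext.covariant_sequence_exact₁ V hS x (h₂ _) (zero_add 1)
  obtain ⟨f, rfl⟩ := (Abelian.Ext.mk₀_bijective _ _).2 y
  obtain ⟨g, rfl⟩ := h f
  rw [← Abelian.Ext.mk₀_comp_mk₀, Abelian.Ext.comp_assoc _ _ _ (add_zero 0) (zero_add 1) (by simp),
    hS.comp_extClass, Abelian.Ext.comp_zero]

lemma kerExt_two_of_kerExt_one [Injective S.X₂] (h : kerExt 1 V S.X₃) : kerExt 2 V S.X₁ := by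
  have := HasExt.standard C
  rw [kerExt_iff_ext] at h ⊢
  intro x
  obtain ⟨y, rfl⟩ := Abelian.Ext.covariant_sequence_exact₁ V hS x
    (Abelian.Ext.eq_zero_of_injective _) (show 1 + 1 = 2 from rfl)
  rw [h y, Abelian.Ext.zero_comp]

end Ext

section Gen

variable {C : Type u} [Category.{v} C] {V : C}

lemma gen_le_subgen : gen V ≤ subgen V := fun X hX => ⟨X, hX, 𝟙 X, inferInstance⟩

lemma gen_coproduct {I : Type v} {c : Cofan fun _ : I => V} (hc : IsColimit c) : gen V c.pt :=
  ⟨I, c, hc, 𝟙 _, inferInstance⟩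

lemma exists_universal_hom [HasCoproducts.{v} C] (V X : C) :
    ∃ (I : Type v) (c : Cofan fun _ : I => V) (_ : IsColimit c) (p : c.pt ⟶ X),
      (∀ f : V ⟶ X, ∃ g : V ⟶ c.pt, g ≫ p = f) ∧ (gen V X → Epi p) := by
  let c : Cofan fun _ : (V ⟶ X) => V := Cofan.mk _ (Sigma.ι fun _ : (V ⟶ X) => V)
  have hc : IsColimit c := coproductIsCoproduct _
  have exists_lift (f : V ⟶ X) : ∃ g : V ⟶ c.pt, g ≫ Cofan.IsColimit.desc hc id = f :=
    ⟨c.inj f, by simp⟩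
  refine ⟨V ⟶ X, c, hc, Cofan.IsColimit.desc hc id, exists_lift, ?_⟩
  rintro ⟨J, d, hd, q, _⟩
  choose g hg using fun j => exists_lift (d.inj j ≫ q)
  have fac : Cofan.IsColimit.desc hd g ≫ Cofan.IsColimit.desc hc id = q :=
    Cofan.IsColimit.hom_ext hd _ _ fun j => by simp [hg]
  exact epi_of_epi_fac fac

end Gen

section WeakTilting

variable {C : Type u} [Category.{v} C] [Abelian C] {V : C}

instance : (gen V).IsClosedUnderIsomorphisms where
  of_iso e hX := gen_of_epi e.hom hX

instance : (pres V).IsClosedUnderIsomorphisms where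
  of_iso {X Y} e := by
    rintro ⟨I, J, c, hc, d, hd, f, p, w, hS, _⟩
    have w' : f ≫ p ≫ e.hom = 0 := by rw [← Category.assoc, w, zero_comp]
    exact ⟨I, J, c, hc, d, hd, f, p ≫ e.hom, w', (ShortComplex.exact_iff_of_iso
      (S₁ := .mk f p w) (S₂ := .mk f (p ≫ e.hom) w')
      (ShortComplex.isoMk (Iso.refl _) (Iso.refl _) e (by simp) (by simp))).1 hS, epi_comp _ _⟩

instance : (kerHom V).IsClosedUnderIsomorphisms where
  of_iso e hX f := by
    rw [← cancel_mono e.inv, hX (f ≫ e.inv), zero_comp]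

lemma pres_le_gen : pres V ≤ gen V := fun _ ⟨I, _, c, hc, _, _, _, p, _, _, hp⟩ =>
  ⟨I, c, hc, p, hp⟩

lemma exists_shortExact_of_pres {X : C} (hX : pres V X) :
    ∃ (I : Type v) (c : Cofan fun _ : I => V) (_ : IsColimit c) (K : C)
      (_ : gen V K) (i : K ⟶ c.pt) (p : c.pt ⟶ X) (w : i ≫ p = 0),
      (ShortComplex.mk i p w).ShortExact := by
  obtain ⟨I, J, c, hc, d, hd, f, p, w, hS, hp⟩ := hX
  have : Epi (kernel.lift p f w) := hS.epi_kernelLift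
  exact ⟨I, c, hc, kernel p, ⟨J, d, hd, kernel.lift p f w, inferInstance⟩, kernel.ι p, p,
    kernel.condition p, { exact := ShortComplex.exact_kernel p }⟩

lemma pres_of_shortExact {X K : C} {I : Type v} {c : Cofan fun _ : I => V} (hc : IsColimit c)
    (hK : gen V K) {i : K ⟶ c.pt} {p : c.pt ⟶ X} {w : i ≫ p = 0}
    (hS : (ShortComplex.mk i p w).ShortExact) : pres V X := by
  obtain ⟨J, d, hd, q, hq⟩ := hK
  have w' : (q ≫ i) ≫ p = 0 := by rw [Category.assoc, w, comp_zero]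
  exact ⟨I, J, c, hc, d, hd, q ≫ i, p, w', (ShortComplex.exact_iff_of_epi_of_isIso_of_mono
    (S₁ := .mk (q ≫ i) p w') (S₂ := .mk i p w) ⟨q, 𝟙 _, 𝟙 _, by simp, by simp⟩).2 hS.exact,
    hS.epi_g⟩

/-- The conditions on `V` which characterize, for self-small `V`, that its stalk complex is a
progenerator of the heart. -/
structure IsWeakTilting (V : C) : Prop where
  pres_eq_gen : pres V = gen V
  gen_le_kerExt_one : gen V ≤ kerExt 1 V
  kerHom_le_kerExt_two : kerHom V ≤ kerExt 2 V
  embeds : ∀ X, kerHom V X → ∃ (Y : C) (_ : gen V Y) (i : X ⟶ Y), Mono i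

lemma hom_eq_zero_of_gen {X Y : C} (hX : gen V X) (hY : kerHom V Y) (f : X ⟶ Y) : f = 0 := by
  obtain ⟨I, c, hc, p, _⟩ := hX
  rw [← cancel_epi p, comp_zero]
  exact Cofan.IsColimit.hom_ext hc _ _ fun i => by rw [hY (c.inj i ≫ p ≫ f), comp_zero]

variable [HasCoproducts.{v} C]

/-- The torsion part of `X` is the trace of `V` in `X`. -/
lemma isTorsionPair_gen (h : gen V ≤ kerExt 1 V) : IsTorsionPair (gen V) (kerHom V) where
  hom_eq_zero X Y hX hY f := hom_eq_zero_of_gen hX hY f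
  exists_shortExact X := by
    obtain ⟨I, c, hc, p, hp, -⟩ := exists_universal_hom V X
    have hS : (ShortComplex.mk (image.ι p) (cokernel.π (image.ι p)) (by simp)).ShortExact :=
      { exact := ShortComplex.exact_cokernel _ }
    have hI : gen V (image p) := ⟨I, c, hc, factorThruImage p, inferInstance⟩
    refine ⟨image p, cokernel (image.ι p), hI, fun f => ?_, _, _, _, hS⟩
    obtain ⟨g, rfl⟩ := exists_lift_of_kerExt_one hS (h _ hI) f
    obtain ⟨k, rfl⟩ := hp g
    have p_comp_π : p ≫ cokernel.π (image.ι p) = 0 :=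
      calc p ≫ cokernel.π (image.ι p)
          = factorThruImage p ≫ image.ι p ≫ cokernel.π (image.ι p) := by rw [image.fac_assoc]
        _ = 0 := by rw [cokernel.condition, comp_zero]
    rw [Category.assoc, p_comp_π, comp_zero]

lemma IsWeakTilting.isTiltingTorsionPair [HasDerivedCategory.{w} C] (h : IsWeakTilting V) :
    IsTiltingTorsionPair (gen V) (kerHom V) V where
  torsionPair := isTorsionPair_gen h.gen_le_kerExt_one
  self := gen_self V
  presentation X hX := exists_shortExact_of_pres (h.pres_eq_gen ▸ hX)
  hom_shift_one X hX := (kerExt_iff_hom 1 (-1) (by simp) X).1 (h.gen_le_kerExt_one X hX)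
  hom_shift_two X hX := (kerExt_iff_hom 2 (-2) (by simp) X).1 (h.kerHom_le_kerExt_two X hX)
  embeds := h.embeds

lemma pres_eq_gen_of_gen_eq (h : gen V = kerExt 1 V) : pres V = gen V :=
  le_antisymm pres_le_gen fun X hX => by
    obtain ⟨I, c, hc, p, hp, epi_p⟩ := exists_universal_hom V X
    have := epi_p hX
    have hS : (ShortComplex.mk (kernel.ι p) p (kernel.condition p)).ShortExact :=
      { exact := ShortComplex.exact_kernel p }
    refine pres_of_shortExact hc ?_ hS
    rw [h]
    exact kerExt_one_of_exists_lift hS (h.le _ (gen_coproduct hc)) hp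

/-- The injective envelope `E` of an object `X` lies in `Gen V`, hence so does `E / X`: the first
embeds `X`, the second computes `Ext^2(V, X)` as `Ext^1(V, E / X)`. -/
lemma isWeakTilting_of_gen_eq [EnoughInjectives C] (h : gen V = kerExt 1 V) :
    IsWeakTilting V := by
  have gen_of_injective (E : C) [Injective E] : gen V E := h.ge _ (kerExt_of_injective 0 E)
  refine ⟨pres_eq_gen_of_gen_eq h, h.le, fun X _ => ?_,
    fun X _ => ⟨Injective.under X, gen_of_injective _, Injective.ι X, inferInstance⟩⟩
  have hS : (ShortComplex.mk (Injective.ι X) (cokernel.π (Injective.ι X)) (by simp)).ShortExact :=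
    { exact := ShortComplex.exact_cokernel _ }
  exact kerExt_two_of_kerExt_one hS
    (h.le _ (gen_of_epi (cokernel.π (Injective.ι X)) (gen_of_injective _)))

end WeakTilting

section Module

open Filter in
lemma eventually_sum_inj_coproductProj_eq {R : Type u} [Ring R] {I : Type t}
    {X : I → ModuleCat.{u} R} {c : Cofan X} (hc : IsColimit c) (y : c.pt) :
    ∀ᶠ s : Finset I in atTop, ∑ j ∈ s, c.inj j (coproductProj hc j y) = y := by
  let N : Submodule R c.pt :=
    { carrier := {y | ∀ᶠ s : Finset I in atTop, ∑ j ∈ s, c.inj j (coproductProj hc j y) = y}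
      zero_mem' := Eventually.of_forall fun s => by simp
      add_mem' := by
        intro a b ha hb
        filter_upwards [ha, hb] with s hs hs'
        simp only [map_add, Finset.sum_add_distrib, hs, hs']
      smul_mem' := by
        intro r a ha
        filter_upwards [ha] with s hs
        simp only [map_smul, ← Finset.smul_sum, hs] }
  have inj_mem (i : I) (x : X i) : c.inj i x ∈ N := by
    filter_upwards [eventually_ge_atTop {i}] with s hs
    rw [Finset.sum_eq_single_of_mem i (hs (by simp)), ← ConcreteCategory.comp_apply (c.inj i),
      inj_coproductProj_self]
    · rfl
    · intro j _ hj
      rw [← ConcreteCategory.comp_apply (c.inj i), inj_coproductProj_of_ne hc hj.symm]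
      simp
  have mkQ_eq_zero : ModuleCat.ofHom N.mkQ = 0 := Cofan.IsColimit.hom_ext hc _ _ fun i => by
    ext x
    simpa using inj_mem i x
  exact (Submodule.Quotient.mk_eq_zero N).1 (congr_arg (fun k => k.hom y) mkQ_eq_zero)

variable {R : Type u} [Ring R]

lemma coproductComparison_surjective (V : ModuleCat.{u} R) [Module.Finite R V] {I : Type t}
    {X : I → ModuleCat.{u} R} {c : Cofan X} (hc : IsColimit c) :
    Function.Surjective (coproductComparison V c) := by
  classical
  intro f
  obtain ⟨S, hS⟩ := (Module.finite_def (R := R) (M := V)).1 inferInstance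
  obtain ⟨s, hs⟩ := ((Filter.eventually_all_finset S).2
    fun v _ => eventually_sum_inj_coproductProj_eq hc (f v)).exists
  refine ⟨∑ j ∈ s, DirectSum.of (fun i => V ⟶ X i) j (f ≫ coproductProj hc j), ?_⟩
  ext v
  have hv : v ∈ Submodule.span R (S : Set V) := hS ▸ Submodule.mem_top
  rw [map_sum]
  simp only [coproductComparison_of]
  induction hv using Submodule.span_induction with
  | mem v hv =>
    refine Eq.trans ?_ (hs v hv)
    simp [ModuleCat.hom_sum]
  | zero => simp
  | add x y _ _ hx hy => rw [map_add, map_add, hx, hy]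
  | smul r x _ hx => rw [map_smul, map_smul, hx]

lemma isSelfSmall_of_finite (V : ModuleCat.{u} R) [Module.Finite R V] : IsSelfSmall V :=
  fun _ _ hc => ⟨coproductComparison_injective V hc, coproductComparison_surjective V hc⟩

variable {V : ModuleCat.{u} R}

lemma IsStalkProgeneratorModule.isWeakTilting (h : IsStalkProgeneratorModule V) :
    IsWeakTilting V where
  pres_eq_gen := h.pres_eq_gen
  gen_le_kerExt_one := h.gen_le_kerExt_one
  kerHom_le_kerExt_two := h.kerHom_le_kerExt_two
  embeds X hX := by
    obtain ⟨Y, hY, i, hi⟩ := h.embeds X hX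
    exact ⟨Y, pres_le_gen _ hY, i, hi⟩

variable [HasDerivedCategory.{w} (ModuleCat.{u} R)]

lemma IsWeakTilting.stalkIsProgenerator (h : IsWeakTilting V) (hV : IsSelfSmall V) :
    StalkIsProgenerator V := by
  rw [StalkIsProgenerator, h.pres_eq_gen]
  exact ⟨h.isTiltingTorsionPair.torsionPair, _, h.isTiltingTorsionPair.isProgenerator hV⟩

lemma IsClassicalOneTilting.stalkIsProgenerator (h : IsClassicalOneTilting V) :
    StalkIsProgenerator V :=
  (isWeakTilting_of_gen_eq h.gen_eq).stalkIsProgenerator h.selfSmall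

lemma IsStalkProgeneratorModule.stalkIsProgenerator (h : IsStalkProgeneratorModule V) :
    StalkIsProgenerator V :=
  have := h.finitePresentation
  h.isWeakTilting.stalkIsProgenerator (isSelfSmall_of_finite V)

end Module

section ProgeneratorConsequences

variable {C : Type u} [Category.{v} C] [Abelian C] [HasDerivedCategory.{w} C]
  {T F : ObjectProperty C}

/-- Stalk complexes of a coproduct are coproducts among bounded below complexes, hence in the
heart. -/
lemma exists_finset_of_isCompactObject [EnoughInjectives C] {P : DerivedCategory C}
    {hP : heart T F P} (hcomp : IsCompactObject.{t} (⟨P, hP⟩ : (heart T F).FullSubcategory))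
    {m : ℤ} {I : Type t} {A : I → C} (hA : ∀ i, heart T F ((singleFunctor C m).obj (A i)))
    {c : Cofan A} (hc : IsColimit c) (hcA : heart T F ((singleFunctor C m).obj c.pt))
    (f : P ⟶ (singleFunctor C m).obj c.pt) :
    ∃ s : Finset I, ∀ Z, heart T F ((singleFunctor C m).obj Z) → ∀ g : c.pt ⟶ Z,
      (∀ i ∈ s, c.inj i ≫ g = 0) → f ≫ (singleFunctor C m).map g = 0 := by
  let X (i : I) : (heart T F).FullSubcategory := ⟨_, hA i⟩
  let d : Cofan X := Cofan.mk (⟨_, hcA⟩ : (heart T F).FullSubcategory) fun i =>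
    ObjectProperty.homMk ((singleFunctor C m).map (c.inj i))
  obtain ⟨hd⟩ : Nonempty (IsColimit d) := by
    have (s : Cofan X) : s.pt.obj.IsGE (-1) := s.pt.property.2.1
    choose desc hdesc using fun s : Cofan X =>
      exists_stalk_coproduct_desc hc (-1) fun i => (s.inj i).hom
    refine ⟨Cofan.IsColimit.mk _ (fun s => ObjectProperty.homMk (desc s))
      (fun s i => ?_) fun s k hk => ?_⟩
    · ext
      exact hdesc s i
    · ext
      exact stalk_coproduct_hom_ext hc (-1) fun i =>
        (congr_arg (fun l => l.hom) (hk i)).trans (hdesc s i).symm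
  obtain ⟨x, hx⟩ := (hcomp I X d hd).2 (ObjectProperty.homMk f)
  obtain ⟨s, hs⟩ := exists_finset_of_coproductComparison d x
  refine ⟨s, fun Z hZ g hg => ?_⟩
  have homMk_comp : (ObjectProperty.homMk f : ⟨P, hP⟩ ⟶ d.pt) ≫
      (ObjectProperty.homMk ((singleFunctor C m).map g) : d.pt ⟶ ⟨_, hZ⟩) = 0 := by
    rw [← hx]
    refine hs _ _ fun i hi => ?_
    ext
    change (singleFunctor C m).map (c.inj i) ≫ (singleFunctor C m).map g = 0
    rw [← Functor.map_comp, hg i hi, Functor.map_zero]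
  exact congr_arg (fun l => l.hom) homMk_comp

lemma exists_finset_ext_of_isCompactObject [EnoughInjectives C] [HasExt.{t} C] {V : C}
    {hV : heart T F ((singleFunctor C 0).obj V)}
    (hcomp : IsCompactObject.{v} (⟨_, hV⟩ : (heart T F).FullSubcategory))
    {n : ℕ} {m : ℤ} (h : n + m = 0) {I : Type v} {A : I → C}
    (hA : ∀ i, heart T F ((singleFunctor C m).obj (A i))) {c : Cofan A} (hc : IsColimit c)
    (hcA : heart T F ((singleFunctor C m).obj c.pt)) (x : Abelian.Ext.{t} V c.pt n) :
    ∃ s : Finset I, ∀ Z, heart T F ((singleFunctor C m).obj Z) → ∀ g : c.pt ⟶ Z,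
      (∀ i ∈ s, c.inj i ≫ g = 0) → x.comp (Abelian.Ext.mk₀ g) (add_zero n) = 0 := by
  let e := (singleFunctors C).shiftIso (n : ℤ) m 0 h
  obtain ⟨s, hs⟩ := exists_finset_of_isCompactObject hcomp hA hc hcA (x.hom ≫ e.hom.app c.pt)
  refine ⟨s, fun Z hZ g hg => ?_⟩
  ext
  rw [Abelian.Ext.comp_hom, Abelian.Ext.mk₀_hom, ShiftedHom.comp_mk₀, Abelian.Ext.zero_hom]
  rw [← cancel_mono (e.hom.app Z), zero_comp, Category.assoc]
  exact (congr_arg _ (e.hom.naturality g)).trans ((Category.assoc _ _ _).symm.trans (hs Z hZ g hg))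

namespace IsTorsionPair

variable [T.IsClosedUnderIsomorphisms] [F.IsClosedUnderIsomorphisms] (h : IsTorsionPair T F)
include h

lemma hom_shift_eq_zero_of_projective {P A : DerivedCategory C} {hP : heart T F P}
    (hproj : Projective (⟨P, hP⟩ : (heart T F).FullSubcategory)) (hA : heart T F A)
    (f : P ⟶ A⟦(1 : ℤ)⟧) : f = 0 := by
  obtain ⟨X, i, g, hT⟩ := distinguished_cocone_triangle₂ f
  let e : (⟨X, h.heart_of_triangle₂ hT hA hP⟩ : (heart T F).FullSubcategory) ⟶ ⟨P, hP⟩ :=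
    ObjectProperty.homMk g
  have : Epi e := Preadditive.epi_of_cancel_zero _ fun {W} k hk => by
    obtain ⟨l, hl⟩ := exists_desc_of_triangle₃ hT k.hom (congr_arg (fun l => l.hom) hk)
    ext
    rw [hl, h.hom_eq_zero_of_shiftedAisle (shiftedAisle_shift hA.1) W.property.2 l, comp_zero]
    rfl
  have section_comp_g : (Projective.factorThru (𝟙 _) e).hom ≫ g = 𝟙 P :=
    congr_arg (fun l => l.hom) (Projective.factorThru_comp (𝟙 _) e)
  have g_comp_f : g ≫ f = 0 := comp_distTriang_mor_zero₂₃ _ hT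
  rw [← Category.id_comp f, ← section_comp_g, Category.assoc, g_comp_f, comp_zero]

variable {V : C} {hV : heart T F ((singleFunctor C 0).obj V)}

lemma kerExt_one_of_projective (hproj : Projective (⟨_, hV⟩ : (heart T F).FullSubcategory))
    {A : C} (hA : T A) : kerExt 1 V A := by
  rw [kerExt_iff_hom 1 (-1) (by simp)]
  intro f
  rw [← cancel_mono (stalkShiftIso 0 (-1) (by simp) A).inv, zero_comp]
  exact h.hom_shift_eq_zero_of_projective hproj (h.heart_stalk hA) _

lemma kerExt_two_of_projective (hproj : Projective (⟨_, hV⟩ : (heart T F).FullSubcategory))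
    {A : C} (hA : F A) : kerExt 2 V A := by
  rw [kerExt_iff_hom 2 (-2) (by simp)]
  intro f
  rw [← cancel_mono (stalkShiftIso (-1) (-2) (by simp) A).inv, zero_comp]
  exact h.hom_shift_eq_zero_of_projective hproj (h.heart_stalk_shift hA) _

/-- The stalk of `A` in degree `-1` is a quotient of some `V^(I)[0]` in the heart; the long exact
cohomology sequence then embeds `A` in the `H^{-1}` of the cone, which is torsion. -/
lemma exists_mono_torsion [EnoughInjectives C] [HasCoproducts.{v} C] (hTV : T V)
    (hsep : IsSeparator (⟨_, hV⟩ : (heart T F).FullSubcategory)) {A : C} (hA : F A) :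
    ∃ (B : C) (_ : T B) (i : A ⟶ B), Mono i := by
  let Y := (singleFunctor C (-1)).obj A
  have hY : heart T F Y := h.heart_stalk_shift hA
  obtain ⟨I, c, hc, e, -, exists_inj_comp_e⟩ :=
    exists_stalk_coproduct_hom V (J := PUnit) (-1) fun _ => 𝟙 Y
  obtain ⟨Z, g, δ, hT⟩ := distinguished_cocone_triangle e
  have eq_zero_of_comp (W) (hW : heart T F W) (k : Y ⟶ W) (hk : e ≫ k = 0) : k = 0 := by
    have homMk_k : (ObjectProperty.homMk k : (⟨Y, hY⟩ : (heart T F).FullSubcategory) ⟶ ⟨W, hW⟩) =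
        0 := (Preadditive.isSeparator_iff _).1 hsep _ fun f => by
      obtain ⟨i, hi⟩ := exists_inj_comp_e ⟨⟩ f.hom
      ext
      change f.hom ≫ k = 0
      rw [← Category.comp_id f.hom, ← hi, Category.assoc, hk, comp_zero]
    exact congr_arg (fun l => l.hom) homMk_k
  have hZ := h.shiftedAisle_of_epi hT
    (h.heart_stalk (h.torsion_coproduct hc fun _ => hTV)) hY eq_zero_of_comp
  have := mono_homology_map₂ hT (-1) (isZero_homology_stalk 0 (-1) (by simp) c.pt)
  exact ⟨_, hZ.2, (homologyStalkIso (-1) A).inv ≫ (homologyFunctor C (-1)).map g, mono_comp _ _⟩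

end IsTorsionPair

end ProgeneratorConsequences

section DirectedSystem

variable {R : Type u} [Ring R]

lemma cofan_induction {I : Type t} {X : I → ModuleCat.{u} R} {c : Cofan X} (hc : IsColimit c)
    {P : c.pt → Prop} (zero : P 0) (add : ∀ a b, P a → P b → P (a + b))
    (inj : ∀ i x, P (c.inj i x)) (y : c.pt) : P y := by
  obtain ⟨s, hs⟩ := (eventually_sum_inj_coproductProj_eq hc y).exists
  rw [← hs]
  exact Finset.sum_induction _ P add zero fun i _ => inj i _

lemma kerHom_coproduct {V : ModuleCat.{u} R} {I : Type t} {X : I → ModuleCat.{u} R} {c : Cofan X}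
    (hc : IsColimit c) (hX : ∀ i, kerHom V (X i)) : kerHom V c.pt := fun f => by
  ext v
  obtain ⟨s, hs⟩ := (eventually_sum_inj_coproductProj_eq hc (f v)).exists
  have coproductProj_apply (i : I) : coproductProj hc i (f v) = 0 :=
    congr_arg (fun l => l.hom v) (hX i (f ≫ coproductProj hc i))
  refine hs.symm.trans (Finset.sum_eq_zero fun i _ => ?_)
  rw [coproductProj_apply, map_zero]

variable {ι : Type u} [SemilatticeSup ι] (M : ι ⥤ ModuleCat.{u} R)
  {c : Cofan M.obj} (hc : IsColimit c)
  {s : Cofan fun p : {p : ι × ι // p.1 ≤ p.2} => M.obj p.1.1} (hs : IsColimit s)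

/-- The map `⨁_{i ≤ j} M i → ⨁ i, M i` whose cokernel is the colimit of `M`. -/
def systemRelations (c : Cofan M.obj) : s.pt ⟶ c.pt :=
  Cofan.IsColimit.desc hs fun p => c.inj p.1.1 - M.map (homOfLE p.2) ≫ c.inj p.1.2

lemma inj_systemRelations (p : {p : ι × ι // p.1 ≤ p.2}) :
    s.inj p ≫ systemRelations M hs c = c.inj p.1.1 - M.map (homOfLE p.2) ≫ c.inj p.1.2 := by
  simp [systemRelations]

open scoped Classical in
/-- The map `⨁ i, M i → M k` given by the transition maps for `i ≤ k`, and by zero otherwise. -/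
def systemProj (k : ι) : c.pt ⟶ M.obj k :=
  Cofan.IsColimit.desc hc fun i => if h : i ≤ k then M.map (homOfLE h) else 0

lemma inj_systemProj {i k : ι} (h : i ≤ k) :
    c.inj i ≫ systemProj M hc k = M.map (homOfLE h) := by
  simp [systemProj, h]

lemma inj_systemRelations_systemProj (p : {p : ι × ι // p.1 ≤ p.2}) {k : ι} (h : p.1.2 ≤ k) :
    s.inj p ≫ systemRelations M hs c ≫ systemProj M hc k = 0 := by
  rw [← Category.assoc, inj_systemRelations, Preadditive.sub_comp, Category.assoc,
    inj_systemProj M hc h, inj_systemProj M hc (p.2.trans h), ← Functor.map_comp]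
  exact sub_self _

include hc in
lemma epi_systemRelations
    (hM : ∀ i (x : M.obj i), ∃ (k : ι) (h : i ≤ k), M.map (homOfLE h) x = 0) :
    Epi (systemRelations M hs c) := by
  rw [ModuleCat.epi_iff_surjective]
  intro y
  induction y using cofan_induction hc with
  | zero => exact ⟨0, map_zero _⟩
  | add a b ha hb =>
    obtain ⟨a, rfl⟩ := ha
    obtain ⟨b, rfl⟩ := hb
    exact ⟨a + b, map_add _ _ _⟩
  | inj i x =>
    obtain ⟨k, h, hx⟩ := hM i x
    refine ⟨s.inj ⟨(i, k), h⟩ x, ?_⟩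
    rw [← ConcreteCategory.comp_apply, inj_systemRelations]
    simp [hx]

open scoped Classical in
/-- The map `⨁ i, M i → ⨁_{i ≤ j} M i` sending `M i` to the summand at `(i, k)` if `i ≤ k`, and to
zero otherwise. Up to the image of `systemSyzygies`, it is eventually a left inverse of
`systemRelations` on each element. -/
def systemSection (s : Cofan fun p : {p : ι × ι // p.1 ≤ p.2} => M.obj p.1.1) (k : ι) :
    c.pt ⟶ s.pt :=
  Cofan.IsColimit.desc hc fun i => if h : i ≤ k then s.inj ⟨(i, k), h⟩ else 0

lemma inj_systemSection {i k : ι} (h : i ≤ k) :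
    c.inj i ≫ systemSection M hc s k = s.inj ⟨(i, k), h⟩ := by
  simp [systemSection, h]

variable {r : Cofan fun q : {q : ι × ι × ι // q.1 ≤ q.2.1 ∧ q.2.1 ≤ q.2.2} => M.obj q.1.1}
  (hr : IsColimit r)

/-- The map `⨁_{i ≤ j ≤ k} M i → ⨁_{i ≤ j} M i` whose image is the kernel of
`systemRelations`. -/
def systemSyzygies (s : Cofan fun p : {p : ι × ι // p.1 ≤ p.2} => M.obj p.1.1) : r.pt ⟶ s.pt :=
  Cofan.IsColimit.desc hr fun q => s.inj ⟨(q.1.1, q.1.2.1), q.2.1⟩ +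
    M.map (homOfLE q.2.1) ≫ s.inj ⟨(q.1.2.1, q.1.2.2), q.2.2⟩ -
    s.inj ⟨(q.1.1, q.1.2.2), q.2.1.trans q.2.2⟩

lemma inj_systemSyzygies (q : {q : ι × ι × ι // q.1 ≤ q.2.1 ∧ q.2.1 ≤ q.2.2}) :
    r.inj q ≫ systemSyzygies M hr s = s.inj ⟨(q.1.1, q.1.2.1), q.2.1⟩ +
      M.map (homOfLE q.2.1) ≫ s.inj ⟨(q.1.2.1, q.1.2.2), q.2.2⟩ -
      s.inj ⟨(q.1.1, q.1.2.2), q.2.1.trans q.2.2⟩ := by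
  simp [systemSyzygies]

lemma systemSyzygies_comp_systemRelations :
    systemSyzygies M hr s ≫ systemRelations M hs c = 0 := by
  refine Cofan.IsColimit.hom_ext hr _ _ fun q => ?_
  rw [← Category.assoc, inj_systemSyzygies, Preadditive.sub_comp, Preadditive.add_comp,
    Category.assoc]
  simp only [inj_systemRelations, comp_zero, Preadditive.comp_sub, ← Category.assoc,
    ← Functor.map_comp, homOfLE_comp]
  abel

lemma eventually_exists_systemSyzygies_eq (y : s.pt) : ∀ᶠ k in Filter.atTop,
    ∃ z, systemSyzygies M hr s z = y - systemSection M hc s k (systemRelations M hs c y) := by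
  induction y using cofan_induction hs with
  | zero => exact Filter.Eventually.of_forall fun k => ⟨0, by simp⟩
  | add a b ha hb =>
    filter_upwards [ha, hb] with k ⟨x, hx⟩ ⟨y, hy⟩
    refine ⟨x + y, ?_⟩
    simp only [map_add, hx, hy]
    abel
  | inj p x =>
    filter_upwards [Filter.eventually_ge_atTop p.1.2] with k hk
    refine ⟨r.inj ⟨(p.1.1, p.1.2, k), p.2, hk⟩ x, ?_⟩
    have hp : s.inj p ≫ systemRelations M hs c ≫ systemSection M hc s k =
        s.inj ⟨(p.1.1, k), p.2.trans hk⟩ - M.map (homOfLE p.2) ≫ s.inj ⟨(p.1.2, k), hk⟩ := by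
      rw [← Category.assoc, inj_systemRelations, Preadditive.sub_comp, Category.assoc,
        inj_systemSection M hc hk, inj_systemSection M hc (p.2.trans hk)]
    simp only [← ConcreteCategory.comp_apply, inj_systemSyzygies, Category.assoc, hp]
    simp
    abel

include hc in
lemma exact_systemSyzygies_systemRelations [Nonempty ι] :
    (ShortComplex.mk (systemSyzygies M hr s) (systemRelations M hs c)
      (systemSyzygies_comp_systemRelations M hs hr)).Exact := by
  rw [ShortComplex.moduleCat_exact_iff]
  intro y (hy : systemRelations M hs c y = 0)
  obtain ⟨k, z, hz⟩ := (eventually_exists_systemSyzygies_eq M hc hs hr y).exists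
  exact ⟨z, by rw [hz, hy, map_zero, sub_zero]⟩

include hc in
/-- A compact object sees the vanishing of the colimit of `M` at a finite stage: the image of `x` in
`Ext^n(V, ⨁ i, M i)` lifts along `systemRelations`, and finitely many relations involve only
indices below some `k`. -/
lemma exists_ext_comp_map_eq_zero [HasExt.{t} (ModuleCat.{u} R)]
    [HasDerivedCategory.{w} (ModuleCat.{u} R)] {T F : ObjectProperty (ModuleCat.{u} R)}
    {V : ModuleCat.{u} R} {hV : heart T F ((singleFunctor (ModuleCat.{u} R) 0).obj V)}
    (hcomp : IsCompactObject.{u} (⟨_, hV⟩ : (heart T F).FullSubcategory))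
    {n : ℕ} {m : ℤ} (h : n + m = 0) (hM : ∀ i (x : M.obj i), ∃ (k : ι) (h : i ≤ k),
      M.map (homOfLE h) x = 0)
    (hMT : ∀ i, heart T F ((singleFunctor _ m).obj (M.obj i)))
    (hsT : heart T F ((singleFunctor _ m).obj s.pt))
    (hK : ∀ y : Abelian.Ext.{t} V (kernel (systemRelations M hs c)) (n + 1), y = 0)
    {i : ι} (x : Abelian.Ext.{t} V (M.obj i) n) :
    ∃ (k : ι) (h : i ≤ k), x.comp (Abelian.Ext.mk₀ (M.map (homOfLE h))) (add_zero n) = 0 := by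
  classical
  have : Nonempty ι := ⟨i⟩
  let d := systemRelations M hs c
  have : Epi d := epi_systemRelations M hc hs hM
  have hd : (ShortComplex.mk (kernel.ι d) d (kernel.condition d)).ShortExact :=
    { exact := ShortComplex.exact_kernel d }
  obtain ⟨y, hy⟩ := Abelian.Ext.covariant_sequence_exact₃ V hd
    (x.comp (Abelian.Ext.mk₀ (c.inj i)) (add_zero n)) rfl (hK _)
  obtain ⟨S, hS⟩ := exists_finset_ext_of_isCompactObject hcomp h (fun _ => hMT _) hs hsT y
  obtain ⟨k, hk⟩ := (insert i (S.image fun p => p.1.2)).exists_le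
  refine ⟨k, hk i (by simp), ?_⟩
  have y_comp : y.comp (Abelian.Ext.mk₀ (d ≫ systemProj M hc k)) (add_zero n) = 0 :=
    hS _ (hMT k) _ fun p hp => inj_systemRelations_systemProj M hc hs p
      (hk _ (Finset.mem_insert_of_mem (Finset.mem_image_of_mem _ hp)))
  rw [← inj_systemProj M hc, ← Abelian.Ext.mk₀_comp_mk₀,
    ← Abelian.Ext.comp_assoc_of_third_deg_zero, ← hy,
    Abelian.Ext.comp_assoc_of_third_deg_zero, Abelian.Ext.mk₀_comp_mk₀]
  exact y_comp

end DirectedSystem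

section FinitePresentation

variable {R : Type u} [Ring R]

section DirectedUnion

variable {ι : Type u} {K : Type u} [AddCommGroup K] [Module R K]

/-- The directed system of the quotients of a module by an increasing family of submodules. -/
def quotientSystem [Preorder ι] (N : ι →o Submodule R K) : ι ⥤ ModuleCat.{u} R where
  obj i := ModuleCat.of R (K ⧸ N i)
  map f := ModuleCat.ofHom (Submodule.factor (N.monotone f.le))
  map_id i := by ext x; simp
  map_comp f g := by ext x; simp

/-- The quotient map `K → K / N i`, as a morphism to the directed system of the quotients. -/
def quotientSystemProj [Preorder ι] (N : ι →o Submodule R K) (i : ι) :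
    ModuleCat.of R K ⟶ (quotientSystem N).obj i :=
  ModuleCat.ofHom (N i).mkQ

lemma quotientSystemProj_map [Preorder ι] (N : ι →o Submodule R K) {i j : ι} (h : i ≤ j) :
    quotientSystemProj N i ≫ (quotientSystem N).map (homOfLE h) = quotientSystemProj N j :=
  rfl

instance [Preorder ι] (N : ι →o Submodule R K) (i : ι) : Epi (quotientSystemProj N i) :=
  (ModuleCat.epi_iff_surjective _).2 (Submodule.mkQ_surjective _)

lemma eq_top_of_quotientSystemProj_eq_zero [Preorder ι] {N : ι →o Submodule R K} {i : ι}
    (h : quotientSystemProj N i = 0) : N i = ⊤ := by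
  rw [← Submodule.ker_mkQ (N i), LinearMap.ker_eq_top]
  exact congr_arg ModuleCat.Hom.hom h

variable [SemilatticeSup ι]

lemma exists_quotientSystem_map_eq_zero (N : ι →o Submodule R K) (hN : ∀ x, ∃ i, x ∈ N i) (i : ι)
    (x : (quotientSystem N).obj i) :
    ∃ (k : ι) (h : i ≤ k), (quotientSystem N).map (homOfLE h) x = 0 := by
  obtain ⟨x, rfl⟩ := Submodule.mkQ_surjective _ x
  obtain ⟨j, hj⟩ := hN x
  exact ⟨i ⊔ j, le_sup_left, (Submodule.Quotient.mk_eq_zero _).2 (N.monotone le_sup_right hj)⟩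

lemma exists_comp_map_eq_zero {M : ι ⥤ ModuleCat.{u} R}
    (hM : ∀ i (x : M.obj i), ∃ (k : ι) (h : i ≤ k), M.map (homOfLE h) x = 0)
    {B : ModuleCat.{u} R} [Module.Finite R B] {i : ι} (f : B ⟶ M.obj i) :
    ∃ (k : ι) (h : i ≤ k), f ≫ M.map (homOfLE h) = 0 := by
  have : Nonempty ι := ⟨i⟩
  obtain ⟨S, hS⟩ := Module.Finite.fg_top (R := R) (M := B)
  have eventually_map_eq_zero (x : M.obj i) :
      ∀ᶠ k in Filter.atTop, ∀ h : i ≤ k, M.map (homOfLE h) x = 0 := by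
    obtain ⟨j, hij, hj⟩ := hM i x
    filter_upwards [Filter.eventually_ge_atTop j] with k hjk h
    rw [← homOfLE_comp hij hjk, Functor.map_comp, ConcreteCategory.comp_apply, hj, map_zero]
  obtain ⟨k, hk, hik⟩ := ((S.eventually_all.2 fun b _ => eventually_map_eq_zero (f b)).and
    (Filter.eventually_ge_atTop i)).exists
  refine ⟨k, hik, ?_⟩
  ext1
  exact LinearMap.ext_on hS fun b hb => hk b hb hik

/-- The class of the pushout of the extension along `A → A / N i` vanishes, so this map extends
to `B`; as `B` is finitely generated, the extension dies at a later stage. -/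
lemma exists_eq_top_of_extClass_comp_eq_zero [HasExt.{t} (ModuleCat.{u} R)]
    {A B D : ModuleCat.{u} R} [Module.Finite R B] {j : A ⟶ B} {p : B ⟶ D} {w : j ≫ p = 0}
    (hS : (ShortComplex.mk j p w).ShortExact) {N : ι →o Submodule R A}
    (hN : ∀ x, ∃ i, x ∈ N i) {i : ι}
    (h : hS.extClass.comp (Abelian.Ext.mk₀ (quotientSystemProj N i)) (add_zero 1) = 0) :
    ∃ k, N k = ⊤ := by
  obtain ⟨e, he⟩ := Abelian.Ext.contravariant_sequence_exact₁ hS _ _ (add_zero 1) h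
  obtain ⟨e, rfl⟩ := (Abelian.Ext.mk₀_bijective _ _).2 e
  have j_comp_e : j ≫ e = quotientSystemProj N i := by
    rw [Abelian.Ext.mk₀_comp_mk₀] at he
    exact (Abelian.Ext.mk₀_bijective _ _).1 he
  obtain ⟨k, hik, hk⟩ := exists_comp_map_eq_zero (exists_quotientSystem_map_eq_zero N hN) e
  refine ⟨k, eq_top_of_quotientSystemProj_eq_zero ?_⟩
  rw [← quotientSystemProj_map N hik, ← j_comp_e, Category.assoc, hk, comp_zero]

end DirectedUnion

section FinsetClosure

variable {T F : ObjectProperty (ModuleCat.{u} R)} {K : Type u} [AddCommGroup K] [Module R K]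

variable (R K) in
/-- The submodules generated by the finite subsets of a module. -/
def finsetSpan : Finset K →o Submodule R K where
  toFun s := Submodule.span R s
  monotone' _ _ h := Submodule.span_mono h

lemma exists_mem_finsetSpan (x : K) : ∃ s, x ∈ finsetSpan R K s :=
  ⟨{x}, Submodule.subset_span (by simp)⟩

variable (F K) in
/-- The common kernel of the homomorphisms to modules of `F` which vanish on a finite set. For a
torsion pair `(T, F)`, the quotient by it is the largest torsion-free quotient of the quotient by
the span of the set. -/
def finsetClosure : Finset K →o Submodule R K where
  toFun s :=
    { carrier := {x | ∀ (B : ModuleCat.{u} R), F B → ∀ f : K →ₗ[R] B, (∀ y ∈ s, f y = 0) → f x = 0}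
      zero_mem' := fun B _ f _ => map_zero f
      add_mem' := fun ha hb B hB f hf => by rw [map_add, ha B hB f hf, hb B hB f hf, add_zero]
      smul_mem' := fun r a ha B hB f hf => by rw [map_smul, ha B hB f hf, smul_zero] }
  monotone' _ _ h _ hx B hB f hf := hx B hB f fun y hy => hf y (h hy)

lemma finsetSpan_le_finsetClosure (s : Finset K) : finsetSpan R K s ≤ finsetClosure F K s :=
  Submodule.span_le.2 fun x hx _ _ _ hf => hf x hx

lemma exists_mem_finsetClosure (x : K) : ∃ s, x ∈ finsetClosure F K s :=
  (exists_mem_finsetSpan x).imp fun s hs => finsetSpan_le_finsetClosure s hs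

namespace IsTorsionPair

lemma finsetClosure_eq_ker (h : IsTorsionPair T F) (s : Finset K) {A B : ModuleCat.{u} R}
    (hA : T A) (hB : F B) {i : A ⟶ (quotientSystem (finsetSpan R K)).obj s}
    {p : (quotientSystem (finsetSpan R K)).obj s ⟶ B} {w : i ≫ p = 0}
    (hS : (ShortComplex.mk i p w).ShortExact) :
    finsetClosure F K s = LinearMap.ker (quotientSystemProj (finsetSpan R K) s ≫ p).hom := by
  apply le_antisymm
  · intro x hx
    refine hx B hB _ fun y hy => ?_
    have mkQ_y : quotientSystemProj (finsetSpan R K) s y = 0 :=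
      (Submodule.Quotient.mk_eq_zero _).2 (Submodule.subset_span hy)
    exact (congr_arg p mkQ_y).trans (map_zero _)
  · intro x hx D hD f hf
    have := hS.epi_g
    let g : (quotientSystem (finsetSpan R K)).obj s ⟶ ModuleCat.of R D :=
      ModuleCat.ofHom ((finsetSpan R K s).liftQ f (Submodule.span_le.2 hf))
    obtain ⟨l, hl : p ≫ l = g⟩ := hS.exact.desc' g (h.hom_eq_zero hA hD _)
    change g (quotientSystemProj (finsetSpan R K) s x) = 0
    rw [← hl]
    exact (congr_arg l hx).trans (map_zero _)

lemma torsionFree_quotientSystem [F.IsClosedUnderIsomorphisms] (h : IsTorsionPair T F)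
    (s : Finset K) : F ((quotientSystem (finsetClosure F K)).obj s) := by
  obtain ⟨A, B, hA, hB, i, p, w, hS⟩ :=
    h.exists_shortExact ((quotientSystem (finsetSpan R K)).obj s)
  have closure_eq := h.finsetClosure_eq_ker s hA hB hS
  let j : (quotientSystem (finsetClosure F K)).obj s ⟶ B :=
    ModuleCat.ofHom ((finsetClosure F K s).liftQ _ closure_eq.le)
  have : Mono j := by
    rw [ModuleCat.mono_iff_ker_eq_bot]
    exact Submodule.ker_liftQ_eq_bot _ _ _ closure_eq.ge
  exact h.torsionFree_of_mono j hB

lemma torsion_of_finsetClosure_eq_top [T.IsClosedUnderIsomorphisms] (h : IsTorsionPair T F)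
    {s : Finset K} (hs : finsetClosure F K s = ⊤) :
    T ((quotientSystem (finsetSpan R K)).obj s) := by
  obtain ⟨A, B, hA, hB, i, p, w, hS⟩ :=
    h.exists_shortExact ((quotientSystem (finsetSpan R K)).obj s)
  have proj_comp_p : quotientSystemProj (finsetSpan R K) s ≫ p = 0 := by
    ext1
    rw [ModuleCat.hom_zero, ← LinearMap.ker_eq_top, ← h.finsetClosure_eq_ker s hA hB hS, hs]
  have hp : p = 0 := by
    rw [← cancel_epi (quotientSystemProj (finsetSpan R K) s), proj_comp_p, comp_zero]
  have : Epi i := hS.exact.epi_f hp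
  exact h.torsion_of_epi i hA

end IsTorsionPair

end FinsetClosure

variable {V : ModuleCat.{u} R} [HasDerivedCategory.{w} (ModuleCat.{u} R)]
  {hV : heart (gen V) (kerHom V) ((singleFunctor (ModuleCat.{u} R) 0).obj V)}

/-- The directed system of the quotients `V / N` by the finitely generated submodules `N` has
colimit zero, so compactness makes one of the maps `V → V / N` vanish. -/
lemma finite_of_isProgenerator (h : IsTorsionPair (gen V) (kerHom V))
    (P : IsProgenerator.{u} (⟨_, hV⟩ : (heart (gen V) (kerHom V)).FullSubcategory)) :
    Module.Finite R V := by
  classical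
  have := HasExt.standard (ModuleCat.{u} R)
  let M := quotientSystem (finsetSpan R V)
  have hM := exists_quotientSystem_map_eq_zero (finsetSpan R V) exists_mem_finsetSpan
  have hgen (s) : gen V (M.obj s) := gen_of_epi (quotientSystemProj _ s) (gen_self V)
  let c := Cofan.mk _ (Sigma.ι M.obj)
  have hc : IsColimit c := coproductIsCoproduct _
  let s := Cofan.mk _ (Sigma.ι fun p : {p : Finset V × Finset V // p.1 ≤ p.2} => M.obj p.1.1)
  have hs : IsColimit s := coproductIsCoproduct _
  let r := Cofan.mk _ (Sigma.ι
    fun q : {q : Finset V × Finset V × Finset V // q.1 ≤ q.2.1 ∧ q.2.1 ≤ q.2.2} => M.obj q.1.1)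
  have hr : IsColimit r := coproductIsCoproduct _
  have gen_kernel : gen V (kernel (systemRelations M hs c)) := by
    have := (exact_systemSyzygies_systemRelations M hc hs hr).epi_kernelLift
    exact gen_of_epi (kernel.lift _ _ (systemSyzygies_comp_systemRelations M hs hr))
      (h.torsion_coproduct hr fun _ => hgen _)
  obtain ⟨k, _, hk⟩ := exists_ext_comp_map_eq_zero M hc hs P.compact (n := 0) (m := 0) (by simp) hM
    (fun i => h.heart_stalk (hgen i)) (h.heart_stalk (h.torsion_coproduct hs fun _ => hgen _))
    ((kerExt_iff_ext 1 _).1 (h.kerExt_one_of_projective P.projective gen_kernel))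
    (Abelian.Ext.mk₀ (quotientSystemProj (finsetSpan R V) ⊥))
  rw [Abelian.Ext.mk₀_comp_mk₀, Abelian.Ext.mk₀_eq_zero_iff] at hk
  exact ⟨k, eq_top_of_quotientSystemProj_eq_zero hk⟩

/-- The same argument in degree `-1`, for the torsion-free quotients of the kernel of an
epimorphism onto `V`, kills the image of the extension class in one of them. -/
lemma exists_finsetClosure_eq_top (h : IsTorsionPair (gen V) (kerHom V))
    (P : IsProgenerator.{u} (⟨_, hV⟩ : (heart (gen V) (kerHom V)).FullSubcategory))
    {K B : ModuleCat.{u} R} [Module.Finite R B] {i : K ⟶ B} {p : B ⟶ V} {w : i ≫ p = 0}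
    (hS : (ShortComplex.mk i p w).ShortExact) : ∃ l, finsetClosure (kerHom V) K l = ⊤ := by
  classical
  have := HasExt.standard (ModuleCat.{u} R)
  let N := finsetClosure (kerHom V) K
  let M := quotientSystem N
  have hF (s) : kerHom V (M.obj s) := h.torsionFree_quotientSystem s
  let c := Cofan.mk _ (Sigma.ι M.obj)
  have hc : IsColimit c := coproductIsCoproduct _
  let s := Cofan.mk _ (Sigma.ι fun p : {p : Finset K × Finset K // p.1 ≤ p.2} => M.obj p.1.1)
  have hs : IsColimit s := coproductIsCoproduct _
  have hsF : kerHom V s.pt := kerHom_coproduct hs fun _ => hF _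
  have kerHom_kernel : kerHom V (kernel (systemRelations M hs c)) :=
    h.torsionFree_of_mono (kernel.ι _) hsF
  obtain ⟨k, _, hk⟩ := exists_ext_comp_map_eq_zero M hc hs P.compact (n := 1) (m := -1) (by simp)
    (exists_quotientSystem_map_eq_zero N exists_mem_finsetClosure)
    (fun s => h.heart_stalk_shift (hF s)) (h.heart_stalk_shift hsF)
    ((kerExt_iff_ext 2 _).1 (h.kerExt_two_of_projective P.projective kerHom_kernel))
    (hS.extClass.comp (Abelian.Ext.mk₀ (quotientSystemProj N ⊥)) (add_zero 1))
  rw [Abelian.Ext.comp_assoc_of_third_deg_zero, Abelian.Ext.mk₀_comp_mk₀,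
    quotientSystemProj_map N] at hk
  exact exists_eq_top_of_extClass_comp_eq_zero hS (N := N) exists_mem_finsetClosure hk

lemma finitePresentation_of_isProgenerator (h : IsTorsionPair (gen V) (kerHom V))
    (P : IsProgenerator.{u} (⟨_, hV⟩ : (heart (gen V) (kerHom V)).FullSubcategory)) :
    Module.FinitePresentation R V := by
  classical
  have := HasExt.standard (ModuleCat.{u} R)
  have := finite_of_isProgenerator h P
  obtain ⟨n, φ, hφ⟩ := Module.Finite.exists_fin' R V
  refine Module.finitePresentation_of_surjective φ hφ ?_
  let K := ModuleCat.of R (LinearMap.ker φ)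
  let i : K ⟶ ModuleCat.of R (Fin n → R) := ModuleCat.ofHom (LinearMap.ker φ).subtype
  let p : ModuleCat.of R (Fin n → R) ⟶ V := ModuleCat.ofHom φ
  have hS : (ShortComplex.mk i p (by ext x; exact x.2)).ShortExact :=
    { exact := (ShortComplex.moduleCat_exact_iff _).2 fun x hx => ⟨⟨x, hx⟩, rfl⟩
      mono_f := (ModuleCat.mono_iff_injective _).2 Subtype.val_injective
      epi_g := (ModuleCat.epi_iff_surjective _).2 hφ }
  obtain ⟨k, hk⟩ := exists_finsetClosure_eq_top h P hS
  have kerExt_quotient : kerExt 1 V ((quotientSystem (finsetSpan R K)).obj k) :=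
    h.kerExt_one_of_projective P.projective (h.torsion_of_finsetClosure_eq_top hk)
  obtain ⟨l, hl⟩ := exists_eq_top_of_extClass_comp_eq_zero hS (i := k)
    (exists_mem_finsetSpan (K := K)) ((kerExt_iff_ext 1 _).1 kerExt_quotient _)
  exact (Submodule.fg_top _).1 ⟨l, hl⟩

theorem StalkIsProgenerator.isStalkProgeneratorModule (h : StalkIsProgenerator V) :
    IsStalkProgeneratorModule V := by
  obtain ⟨h, hV, P⟩ := h
  have hTV : pres V V := (pres V).prop_of_iso (homologyStalkIso 0 V) hV.1.2
  have pres_eq_gen : pres V = gen V := le_antisymm pres_le_gen fun X hX => by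
    obtain ⟨I, c, hc, p, _⟩ := hX
    exact h.torsion_of_epi p (h.torsion_coproduct hc fun _ => hTV)
  generalize hT : pres V = T at h hV P hTV pres_eq_gen
  subst pres_eq_gen
  exact
    { finitePresentation := finitePresentation_of_isProgenerator h P
      pres_eq_gen := hT
      gen_le_kerExt_one := fun X hX => h.kerExt_one_of_projective P.projective hX
      kerHom_le_kerExt_two := fun X hX => h.kerExt_two_of_projective P.projective hX
      embeds := fun X hX => hT ▸ h.exists_mono_torsion hTV P.generator hX }

end FinitePresentation

section SubgenGrothendieck

variable {R : Type u} [Ring R] {V : ModuleCat.{u} R}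

lemma subgen_coproduct (h : gen V ≤ kerExt 1 V) {I : Type u} {X : I → ModuleCat.{u} R}
    (hX : ∀ i, subgen V (X i)) : subgen V (∐ X) := by
  choose Y hY i hi using hX
  exact ⟨∐ Y, (isTorsionPair_gen h).torsion_coproduct (coproductIsCoproduct Y) hY,
    Limits.Sigma.map i, inferInstance⟩

lemma isClosedUnderColimitsOfShape_subgen (h : gen V ≤ kerExt 1 V) (J : Type u)
    [SmallCategory J] : (subgen V).IsClosedUnderColimitsOfShape J :=
  .mk' <| by
    rintro _ ⟨F, hF⟩
    have : Epi (Sigma.desc (colimit.ι F)) := ⟨fun f g hfg => by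
      refine colimit.hom_ext fun j => ?_
      simpa using Sigma.ι F.obj j ≫= hfg⟩
    exact (subgen V).prop_of_epi (Sigma.desc (colimit.ι F)) (subgen_coproduct h hF)

lemma hasColimitsOfSize_subgen (h : gen V ≤ kerExt 1 V) :
    HasColimitsOfSize.{u, u} (Subgen V) where
  has_colimits_of_shape J _ := by
    have := isClosedUnderColimitsOfShape_subgen h J
    infer_instance

lemma preservesColimitsOfShape_incl (h : gen V ≤ kerExt 1 V) (J : Type u) [SmallCategory J] :
    PreservesColimitsOfShape J (Subgen.incl V) := by
  have := isClosedUnderColimitsOfShape_subgen h J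
  infer_instance

/-- The cyclic modules `R ⧸ J` in `Subgen V` separate, since every `x : X` generates one. -/
lemma hasSeparator_subgen (h : gen V ≤ kerExt 1 V) : HasSeparator (Subgen V) := by
  have := hasColimitsOfSize_subgen h
  let β := {J : Submodule R R // subgen V (ModuleCat.of R (R ⧸ J))}
  let G : β → Subgen V := fun J => ⟨_, J.2⟩
  refine ⟨∐ G, (isSeparator_sigma G).2 fun X Y f g hfg => ?_⟩
  ext x
  let φ : R →ₗ[R] X.obj := LinearMap.toSpanSingleton R X.obj x
  let i : ModuleCat.of R (R ⧸ LinearMap.ker φ) ⟶ X.obj :=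
    ModuleCat.ofHom ((LinearMap.ker φ).liftQ φ le_rfl)
  have : Mono i := by
    rw [ModuleCat.mono_iff_ker_eq_bot]
    exact Submodule.ker_liftQ_eq_bot _ _ _ le_rfl
  let J : β := ⟨LinearMap.ker φ, (subgen V).prop_of_mono i X.property⟩
  have i_mkQ_one : i ((LinearMap.ker φ).mkQ 1) = x := one_smul R x
  have agree_on_cyclic : f.hom (i ((LinearMap.ker φ).mkQ 1)) = g.hom (i _) :=
    congr_arg (fun l => l.hom ((LinearMap.ker φ).mkQ 1)) (hfg (G J) ⟨J⟩ (ObjectProperty.homMk i))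
  rwa [i_mkQ_one] at agree_on_cyclic

lemma isGrothendieckAbelian_subgen (h : gen V ≤ kerExt 1 V) :
    IsGrothendieckAbelian.{u} (Subgen V) := by
  have := hasColimitsOfSize_subgen h
  have : HasFilteredColimitsOfSize.{u, u} (Subgen V) := ⟨fun J _ _ => inferInstance⟩
  have : ReflectsFiniteLimits (Subgen.incl V) :=
    ⟨fun J _ _ => inferInstance⟩
  have := hasSeparator_subgen h
  exact
    { ab5OfSize := ⟨fun J _ _ => by
        have := preservesColimitsOfShape_incl h J
        exact HasExactColimitsOfShape.domain_of_functor J (Subgen.incl V)⟩ }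

end SubgenGrothendieck

section SubobjectOfGen

variable {C : Type u} [Category.{v} C] [Abelian C] {V X Y : C}

lemma exact_pullback_snd {K P Z : C} {q : Y ⟶ Z} {j : K ⟶ P} {p : P ⟶ Z} {w : j ≫ p = 0} [Mono j]
    (hS : (ShortComplex.mk j p w).Exact) :
    (ShortComplex.mk (pullback.lift 0 j (by simp [w]) : K ⟶ pullback q p) (pullback.fst q p)
      (pullback.lift_fst _ _ _)).Exact := by
  have : Mono (pullback.lift 0 j (by simp [w]) : K ⟶ pullback q p) :=
    mono_of_mono_fac (pullback.lift_snd _ _ _)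
  refine ShortComplex.exact_of_f_is_kernel _ (KernelFork.IsLimit.ofι' _ _ fun f hf => ?_)
  have hf' : (f ≫ pullback.snd q p) ≫ p = 0 := by
    rw [Category.assoc, ← pullback.condition, ← Category.assoc, hf, zero_comp]
  refine ⟨hS.lift _ hf', pullback.hom_ext ?_ ?_⟩
  · rw [Category.assoc, pullback.lift_fst, comp_zero, hf]
  · rw [Category.assoc, pullback.lift_snd]
    exact hS.lift_f _ hf'

variable [HasCoproducts.{v} C]

/-- The pullback of `Y ⟶ cokernel i` along a presentation `c.pt ⟶ cokernel i` is an extension of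
`Y` by the syzygy of the presentation, hence lies in `gen V`. Since the presentation lifts to `Y`,
the pullback retracts onto `X`. -/
lemma IsWeakTilting.gen_of_mono (h : IsWeakTilting V) (hY : gen V Y) (i : X ⟶ Y) [Mono i]
    (hlift : ∀ f : V ⟶ cokernel i, ∃ g : V ⟶ Y, g ≫ cokernel.π i = f) : gen V X := by
  have hcoker : pres V (cokernel i) := h.pres_eq_gen ▸ gen_of_epi (cokernel.π i) hY
  obtain ⟨I, c, hc, K, hK, j, p, w, hS⟩ := exists_shortExact_of_pres hcoker
  have := hS.mono_f
  have := hS.epi_g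
  have gen_pullback : gen V (pullback (cokernel.π i) p) :=
    (isTorsionPair_gen h.gen_le_kerExt_one).torsion_of_exact
      (exact_pullback_snd (q := cokernel.π i) hS.exact) hK hY
  choose g hg using fun a => hlift (c.inj a ≫ p)
  let l : c.pt ⟶ Y := Cofan.IsColimit.desc hc g
  have hl : l ≫ cokernel.π i = p := Cofan.IsColimit.hom_ext hc _ _ fun a => by simp [l, hg]
  have hi : (ShortComplex.mk i (cokernel.π i) (by simp)).Exact := ShortComplex.exact_cokernel i
  let r : pullback (cokernel.π i) p ⟶ X := hi.lift (pullback.fst _ _ - pullback.snd _ _ ≫ l) (by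
    simp [hl, pullback.condition])
  let s : X ⟶ pullback (cokernel.π i) p := pullback.lift i 0 (by simp)
  have hr : r ≫ i = pullback.fst _ _ - pullback.snd _ _ ≫ l := hi.lift_f _ _
  have s_comp_r : s ≫ r = 𝟙 X := by
    rw [← cancel_mono i, Category.assoc, hr, Preadditive.comp_sub, pullback.lift_fst,
      pullback.lift_snd_assoc, zero_comp, sub_zero, Category.id_comp]
  have : Epi r := (SplitEpi.mk s s_comp_r).epi
  exact gen_of_epi r gen_pullback

end SubobjectOfGen

section SubgenTilting

variable {R : Type u} [Ring R] {V : ModuleCat.{u} R}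

lemma shortExact_of_incl {A B D : Subgen V} {i : A ⟶ B} {p : B ⟶ D} {w : i ≫ p = 0}
    (hS : (ShortComplex.mk i.hom p.hom (congr_arg (fun l => l.hom) w)).ShortExact) :
    (ShortComplex.mk i p w).ShortExact where
  exact := ((ShortComplex.mk i p w).exact_map_iff_of_faithful (Subgen.incl V)).1 hS.exact
  mono_f := (Subgen.incl V).mono_of_mono_map hS.mono_f
  epi_g := (Subgen.incl V).epi_of_epi_map hS.epi_g

lemma gen_subgenSelf_iff (h : gen V ≤ kerExt 1 V) (X : Subgen V) :
    gen (Subgen.self V) X ↔ gen V X.obj := by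
  constructor
  · rintro ⟨I, c, hc, p, _⟩
    have := preservesColimitsOfShape_incl h (Discrete I)
    let d : Cofan fun _ : I => V := Cofan.mk c.pt.obj fun i => (c.inj i).hom
    have hd : IsColimit d := isColimitCofanMkObjOfIsColimit (Subgen.incl V) _ _ hc
    exact ⟨I, d, hd, p.hom, inferInstanceAs (Epi ((Subgen.incl V).map p))⟩
  · rintro ⟨I, c, hc, p, hp⟩
    let d : Cofan fun _ : I => Subgen.self V :=
      Cofan.mk ⟨c.pt, gen_le_subgen _ (gen_coproduct hc)⟩ fun i => ObjectProperty.homMk (c.inj i)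
    have hd : IsColimit d := Cofan.IsColimit.mk _
      (fun s => ObjectProperty.homMk (Cofan.IsColimit.desc hc fun i => (s.inj i).hom))
      (fun s i => by ext : 1; exact Cofan.IsColimit.fac hc _ i)
      (fun s m hm => by
        ext : 1
        refine Cofan.IsColimit.hom_ext hc _ _ fun i => ?_
        exact (congr_arg (fun l => l.hom) (hm i)).trans
          (Cofan.IsColimit.fac hc (fun i => (s.inj i).hom) i).symm)
    exact ⟨I, d, hd, ObjectProperty.homMk p, (Subgen.incl V).epi_of_epi_map hp⟩

lemma kerHom_subgenSelf_iff (X : Subgen V) : kerHom (Subgen.self V) X ↔ kerHom V X.obj :=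
  ⟨fun hX f => congr_arg (fun l => l.hom) (hX (ObjectProperty.homMk f)), fun hX f => by
    ext : 1
    exact hX f.hom⟩

lemma torsionIn_eq (h : gen V ≤ kerExt 1 V) (hpres : pres V = gen V) :
    torsionIn V = gen (Subgen.self V) := by
  ext X
  rw [torsionIn, hpres, gen_subgenSelf_iff h]
  rfl

lemma torsionFreeIn_eq : torsionFreeIn V = kerHom (Subgen.self V) := by
  ext X
  rw [kerHom_subgenSelf_iff]
  rfl

lemma kerExt_one_subgenSelf_of_gen (h : gen V ≤ kerExt 1 V) {X : Subgen V} (hX : gen V X.obj) :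
    kerExt 1 (Subgen.self V) X := by
  have := isGrothendieckAbelian_subgen h
  have hS : (ShortComplex.mk (Injective.ι X) (cokernel.π (Injective.ι X)) (by simp)).ShortExact :=
    { exact := ShortComplex.exact_cokernel _ }
  refine kerExt_one_of_exists_lift hS (kerExt_of_injective 0 _) fun f => ?_
  obtain ⟨g, hg⟩ :=
    exists_lift_of_kerExt_one (hS.map_of_exact (Subgen.incl V)) (h _ hX) f.hom
  exact ⟨ObjectProperty.homMk g, by ext : 1; exact hg⟩

lemma IsWeakTilting.gen_of_kerExt_one_subgenSelf (h : IsWeakTilting V) {X : Subgen V}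
    (hX : kerExt 1 (Subgen.self V) X) : gen V X.obj := by
  obtain ⟨Y, hY, i, _⟩ := X.property
  refine h.gen_of_mono hY i fun f => ?_
  let Y' : Subgen V := ⟨Y, gen_le_subgen _ hY⟩
  let Z' : Subgen V := ⟨cokernel i, (subgen V).prop_of_epi (cokernel.π i) Y'.property⟩
  let i' : X ⟶ Y' := ObjectProperty.homMk i
  let p' : Y' ⟶ Z' := ObjectProperty.homMk (cokernel.π i)
  have w : i' ≫ p' = 0 := by ext : 1; exact cokernel.condition i
  have hS : (ShortComplex.mk i' p' w).ShortExact := shortExact_of_incl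
    { exact := ShortComplex.exact_cokernel i
      mono_f := by assumption
      epi_g := inferInstanceAs (Epi (cokernel.π i)) }
  obtain ⟨g, hg⟩ := exists_lift_of_kerExt_one hS hX (ObjectProperty.homMk f : Subgen.self V ⟶ Z')
  exact ⟨g.hom, congr_arg (fun l => l.hom) hg⟩

lemma IsWeakTilting.gen_subgenSelf_eq (h : IsWeakTilting V) :
    gen (Subgen.self V) = kerExt 1 (Subgen.self V) := by
  ext X
  rw [gen_subgenSelf_iff h.gen_le_kerExt_one]
  exact ⟨kerExt_one_subgenSelf_of_gen h.gen_le_kerExt_one, h.gen_of_kerExt_one_subgenSelf⟩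

lemma isSelfSmall_subgenSelf (h : gen V ≤ kerExt 1 V) [Module.Finite R V] :
    IsSelfSmall (Subgen.self V) := by
  intro I c hc
  refine ⟨coproductComparison_injective _ hc, fun f => ?_⟩
  have := preservesColimitsOfShape_incl h (Discrete I)
  let d : Cofan fun _ : I => V := Cofan.mk c.pt.obj fun i => (c.inj i).hom
  have hd : IsColimit d := isColimitCofanMkObjOfIsColimit (Subgen.incl V) _ _ hc
  obtain ⟨x, hx⟩ := coproductComparison_surjective V hd f.hom
  let homMk : (V ⟶ d.pt) →+ (Subgen.self V ⟶ c.pt) :=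
    { toFun f := ObjectProperty.homMk f, map_zero' := rfl, map_add' _ _ := rfl }
  obtain ⟨y, hy⟩ := map_coproductComparison_mem_range d c homMk
    (fun i g => ⟨i, ObjectProperty.homMk g, rfl⟩) x
  exact ⟨y, hy.trans (congr_arg homMk hx)⟩

lemma IsWeakTilting.isClassicalOneTilting_subgenSelf (h : IsWeakTilting V) [Module.Finite R V] :
    IsClassicalOneTilting (Subgen.self V) :=
  ⟨h.gen_subgenSelf_eq, isSelfSmall_subgenSelf h.gen_le_kerExt_one⟩

lemma IsWeakTilting.subgenSelf (h : IsWeakTilting V) : IsWeakTilting (Subgen.self V) :=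
  have := isGrothendieckAbelian_subgen h.gen_le_kerExt_one
  isWeakTilting_of_gen_eq h.gen_subgenSelf_eq

end SubgenTilting

section StalkCone

variable {C : Type u} [Category.{v} C] [Abelian C] [HasDerivedCategory.{w} C]

lemma eq_zero_of_comp_mor₁_eq_zero {W X Y Z : DerivedCategory C} {f : X ⟶ Y} {g : Y ⟶ Z}
    {δ : Z ⟶ X⟦(1 : ℤ)⟧} (hT : Triangle.mk f g δ ∈ distTriang _)
    (hW : ∀ m : W⟦(1 : ℤ)⟧ ⟶ Z, m = 0) (l : W ⟶ X) (hl : l ≫ f = 0) : l = 0 := by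
  have hl' : l⟦(1 : ℤ)⟧' ≫ f⟦(1 : ℤ)⟧' = 0 := by rw [← Functor.map_comp, hl, Functor.map_zero]
  obtain ⟨m, hm⟩ : ∃ m : W⟦(1 : ℤ)⟧ ⟶ Z, l⟦(1 : ℤ)⟧' = m ≫ δ :=
    Triangle.coyoneda_exact₁ _ hT (l⟦(1 : ℤ)⟧') hl'
  apply (shiftFunctor (DerivedCategory C) (1 : ℤ)).map_injective
  rw [hm, hW m, zero_comp, Functor.map_zero]

variable {M N : C} {a : M ⟶ N} {X : DerivedCategory C} {p : (singleFunctor C 0).obj N ⟶ X}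
  {δ : X ⟶ ((singleFunctor C 0).obj M)⟦(1 : ℤ)⟧}
  (hT : Triangle.mk ((singleFunctor C 0).map a) p δ ∈ distTriang _)

include hT in
lemma exists_mono_homology_of_stalk : ∃ (i : (homologyFunctor C (-1)).obj X ⟶ M) (w : i ≫ a = 0),
    Mono i ∧ (ShortComplex.mk i a w).Exact := by
  obtain ⟨d, w, _, hd⟩ := exists_mono_homology₃ hT (-1) 0 rfl
    (isZero_homology_stalk 0 (-1) (by simp) N)
  have hw : (d ≫ (homologyStalkIso 0 M).hom) ≫ a = 0 := by
    rw [Category.assoc, ← homologyStalkIso_hom_naturality, ← Category.assoc, w, zero_comp]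
  refine ⟨d ≫ (homologyStalkIso 0 M).hom, hw, mono_comp _ _, ?_⟩
  exact (ShortComplex.exact_iff_of_iso (S₁ := ShortComplex.mk _ _ w)
    (S₂ := ShortComplex.mk _ _ hw) (ShortComplex.isoMk (Iso.refl _) (homologyStalkIso 0 M)
      (homologyStalkIso 0 N) (by simp) (homologyStalkIso_hom_naturality 0 a).symm)).1 hd

variable {T F : ObjectProperty C} [T.IsClosedUnderIsomorphisms]

include hT in
lemma IsTorsionPair.heart_of_stalk (h : IsTorsionPair T F) (hN : T N)
    (hX : F ((homologyFunctor C (-1)).obj X)) : heart T F X := by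
  have : ((singleFunctor C 0).obj M).IsLE (0 + 1) := TStructure.t.isLE_of_le _ 0 _
  have : ((singleFunctor C 0).obj N).IsGE (-1) := TStructure.t.isGE_of_ge _ _ 0
  have : Epi ((homologyFunctor C 0).map p) := epi_homology_map₂ hT 0 1 rfl
    (isZero_homology_stalk 0 1 (by simp) M)
  exact ⟨⟨isLE_of_triangle₃ hT 0 _ rfl, h.torsion_of_epi ((homologyFunctor C 0).map p)
    (T.prop_of_iso (homologyStalkIso 0 N).symm hN)⟩, isGE_of_triangle₃ hT (-1) 0 rfl, hX⟩

end StalkCone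

section HeartFunctor

universe w' u'

variable {C : Type u} [Category.{v} C] [Abelian C] [HasDerivedCategory.{w} C]
  {D : Type u'} [Category.{v} D] [Abelian D] [HasDerivedCategory.{w'} D]
  (E : C ⥤ D) [E.Additive] [PreservesFiniteLimits E] [PreservesFiniteColimits E]

lemma map_triangle {X Y Z : DerivedCategory C} {f : X ⟶ Y} {g : Y ⟶ Z} {δ : Z ⟶ X⟦(1 : ℤ)⟧}
    (hT : Triangle.mk f g δ ∈ distTriang _) :
    Triangle.mk (E.mapDerivedCategory.map f) (E.mapDerivedCategory.map g)
      (E.mapDerivedCategory.map δ ≫ (E.mapDerivedCategory.commShiftIso (1 : ℤ)).hom.app X) ∈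
        distTriang _ :=
  E.mapDerivedCategory.map_distinguished _ hT

/-- The identification of the image of a stalk complex under the derived functor of an exact
functor. -/
def mapStalkIso (n : ℤ) (A : C) : E.mapDerivedCategory.obj ((singleFunctor C n).obj A) ≅
    (singleFunctor D n).obj (E.obj A) :=
  (E.mapDerivedCategorySingleFunctor n).app A

lemma mapStalkIso_hom_naturality (n : ℤ) {A B : C} (f : A ⟶ B) :
    E.mapDerivedCategory.map ((singleFunctor C n).map f) ≫ (mapStalkIso E n B).hom =
      (mapStalkIso E n A).hom ≫ (singleFunctor D n).map (E.map f) :=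
  (E.mapDerivedCategorySingleFunctor n).hom.naturality f

lemma mapStalkIso_inv_naturality (n : ℤ) {A B : C} (f : A ⟶ B) :
    (mapStalkIso E n A).inv ≫ E.mapDerivedCategory.map ((singleFunctor C n).map f) =
      (singleFunctor D n).map (E.map f) ≫ (mapStalkIso E n B).inv :=
  ((E.mapDerivedCategorySingleFunctor n).inv.naturality f).symm

lemma map_injective_of_eq_zero {X Y : DerivedCategory C}
    (h : ∀ f : X ⟶ Y, E.mapDerivedCategory.map f = 0 → f = 0) :
    Function.Injective (E.mapDerivedCategory.map : (X ⟶ Y) → _) :=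
  (injective_iff_map_eq_zero (E.mapDerivedCategory.mapAddHom (X := X) (Y := Y))).2 h

lemma map_stalk_injective [E.Faithful] (A B : C) :
    Function.Injective (E.mapDerivedCategory.map :
      ((singleFunctor C 0).obj A ⟶ (singleFunctor C 0).obj B) → _) := by
  intro f g hfg
  obtain ⟨f, rfl⟩ := (singleFunctor C 0).map_surjective f
  obtain ⟨g, rfl⟩ := (singleFunctor C 0).map_surjective g
  congr 1
  apply E.map_injective
  apply (singleFunctor D 0).map_injective
  rw [← cancel_epi (mapStalkIso E 0 A).hom, ← mapStalkIso_hom_naturality, hfg,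
    mapStalkIso_hom_naturality]

lemma map_stalk_surjective [E.Full] (A B : C) :
    Function.Surjective (E.mapDerivedCategory.map :
      ((singleFunctor C 0).obj A ⟶ (singleFunctor C 0).obj B) → _) := by
  intro f
  obtain ⟨g, hg⟩ := (singleFunctor D 0).map_surjective
    ((mapStalkIso E 0 A).inv ≫ f ≫ (mapStalkIso E 0 B).hom)
  obtain ⟨g, rfl⟩ := E.map_surjective g
  refine ⟨(singleFunctor C 0).map g, ?_⟩
  rw [← cancel_mono (mapStalkIso E 0 B).hom, mapStalkIso_hom_naturality, hg]
  simp

lemma exists_mono_map_homology_of_stalk {M N : C} {a : M ⟶ N} {X : DerivedCategory C}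
    {p : (singleFunctor C 0).obj N ⟶ X} {δ : X ⟶ ((singleFunctor C 0).obj M)⟦(1 : ℤ)⟧}
    (hX : Triangle.mk ((singleFunctor C 0).map a) p δ ∈ distTriang _) {Y : DerivedCategory D}
    {q : (singleFunctor D 0).obj (E.obj N) ⟶ Y}
    {ε : Y ⟶ ((singleFunctor D 0).obj (E.obj M))⟦(1 : ℤ)⟧}
    (hY : Triangle.mk ((singleFunctor D 0).map (E.map a)) q ε ∈ distTriang _) :
    ∃ l : E.obj ((homologyFunctor C (-1)).obj X) ⟶ (homologyFunctor D (-1)).obj Y, Mono l := by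
  obtain ⟨i, w, _, -⟩ := exists_mono_homology_of_stalk hX
  obtain ⟨i', w', _, hi'⟩ := exists_mono_homology_of_stalk hY
  have map_i_comp : E.map i ≫ E.map a = 0 := by rw [← Functor.map_comp, w, Functor.map_zero]
  obtain ⟨l, hl⟩ := hi'.lift' (E.map i) map_i_comp
  exact ⟨l, mono_of_mono_fac hl⟩

variable {T₁ F₁ : ObjectProperty C} {T₂ F₂ : ObjectProperty D} {V : C}
  (h₁ : IsTiltingTorsionPair T₁ F₁ V) (h₂ : IsTiltingTorsionPair T₂ F₂ (E.obj V))
  (hT : ∀ X, T₁ X → T₂ (E.obj X)) (hF : ∀ X, F₁ X → F₂ (E.obj X))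

section StalkShift

variable [E.Full] [E.Faithful]
include h₁ h₂ hT

lemma map_stalk_shift_bijective {B : C} (hB : F₁ B) :
    Function.Bijective (E.mapDerivedCategory.map :
      ((singleFunctor C 0).obj V ⟶ (singleFunctor C (-1)).obj B) → _) := by
  obtain ⟨A, hA, i, _⟩ := h₁.embeds B hB
  have hS : (ShortComplex.mk i (cokernel.π i) (by simp)).ShortExact :=
    { exact := ShortComplex.exact_cokernel i }
  obtain ⟨δ, ε, hX⟩ := exists_triangle_of_shortExact hS
  constructor
  · refine map_injective_of_eq_zero E fun f hf => ?_
    obtain ⟨k, rfl⟩ := exists_lift_of_triangle₃ hX f (by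
      rw [← cancel_mono (stalkShiftIso 0 (-1) (by simp) A).hom, zero_comp]
      exact h₁.hom_shift_one A hA _)
    obtain ⟨m, hm⟩ := exists_lift_of_triangle₂ (map_triangle E hX) (E.mapDerivedCategory.map k)
      (by rw [← Functor.map_comp]; exact hf)
    obtain ⟨m, rfl⟩ := map_stalk_surjective E _ _ m
    rw [← Functor.map_comp] at hm
    have map_π_comp_δ : (singleFunctor C 0).map (cokernel.π i) ≫ δ = 0 :=
      comp_distTriang_mor_zero₁₂ _ hX
    rw [map_stalk_injective E _ _ hm, Category.assoc, map_π_comp_δ, comp_zero]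
  · intro g
    obtain ⟨k, rfl⟩ := exists_lift_of_triangle₃ (map_triangle E hX) g (by
      let e : (E.mapDerivedCategory.obj ((singleFunctor C 0).obj A))⟦(1 : ℤ)⟧ ≅
          (singleFunctor D (-1)).obj (E.obj A) :=
        (shiftFunctor _ (1 : ℤ)).mapIso (mapStalkIso E 0 A) ≪≫ stalkShiftIso 0 (-1) (by simp) _
      rw [← cancel_mono e.hom, zero_comp, ← cancel_epi (mapStalkIso E 0 V).inv, comp_zero]
      exact h₂.hom_shift_one _ (hT A hA) _)
    obtain ⟨k, rfl⟩ := map_stalk_surjective E _ _ k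
    exact ⟨k ≫ δ, Functor.map_comp _ _ _⟩

end StalkShift

variable [T₂.IsClosedUnderIsomorphisms] [F₂.IsClosedUnderIsomorphisms]

include h₂ hT hF in
lemma heart_map {X : DerivedCategory C} (hX : heart T₁ F₁ X) :
    heart T₂ F₂ (E.mapDerivedCategory.obj X) := by
  obtain ⟨B, A, hB, hA, i, p, δ, hX⟩ := exists_heart_triangle hX
  exact h₂.torsionPair.heart_of_triangle₂ (map_triangle E hX)
    ((heart T₂ F₂).prop_of_iso (mapStalkIso E (-1) B).symm
      (h₂.torsionPair.heart_stalk_shift (hF B hB)))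
    ((heart T₂ F₂).prop_of_iso (mapStalkIso E 0 A).symm (h₂.torsionPair.heart_stalk (hT A hA)))

include h₂ in
lemma exists_heart_map_iso [E.Full] [EnoughInjectives D] [HasCoproducts.{v} D]
    [T₁.IsClosedUnderIsomorphisms] (ht : IsTorsionPair T₁ F₁)
    (hess : ∀ Y, T₂ Y → ∃ X, T₁ X ∧ Nonempty (E.obj X ≅ Y))
    (hF' : ∀ X, F₂ (E.obj X) → F₁ X) {Y : DerivedCategory D} (hY : heart T₂ F₂ Y) :
    ∃ X, heart T₁ F₁ X ∧ Nonempty (E.mapDerivedCategory.obj X ≅ Y) := by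
  obtain ⟨I, c, hc, M, hM, a, p, δ, hT⟩ := h₂.exists_presentation hY
  obtain ⟨N, hN, ⟨e⟩⟩ := hess c.pt (h₂.torsionPair.torsion_coproduct hc fun _ => h₂.self)
  obtain ⟨M', -, ⟨e'⟩⟩ := hess M hM
  obtain ⟨b, hb⟩ := E.map_surjective (e'.hom ≫ a ≫ e.inv)
  obtain ⟨X, q, ε, hX⟩ := distinguished_cocone_triangle ((singleFunctor C 0).map b)
  have hT' := distinguished_of_iso hT ((singleFunctor D 0).mapIso e')
    ((singleFunctor D 0).mapIso e) (Iso.refl _) (f' := (singleFunctor D 0).map (E.map b))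
    (by rw [hb]; simp) rfl
  obtain ⟨l, _⟩ := exists_mono_map_homology_of_stalk E hX hT'
  exact ⟨X, ht.heart_of_stalk hX hN (hF' _ (h₂.torsionPair.torsionFree_of_mono l hY.2.2)),
    ⟨Triangle.π₃.mapIso (isoTriangleOfIso₁₂ _ _ (map_triangle E hX) hT' (mapStalkIso E 0 M')
      (mapStalkIso E 0 N) (mapStalkIso_hom_naturality E 0 b))⟩⟩

variable [E.Full] [E.Faithful]

include h₁ h₂ hT

lemma map_self_bijective {Y : DerivedCategory C} (hY : heart T₁ F₁ Y) :
    Function.Bijective (E.mapDerivedCategory.map : ((singleFunctor C 0).obj V ⟶ Y) → _) := by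
  obtain ⟨B, A, hB, hA, i, p, δ, hY⟩ := exists_heart_triangle hY
  have hbij := map_stalk_shift_bijective E h₁ h₂ hT hB
  constructor
  · refine map_injective_of_eq_zero E fun f hf => ?_
    obtain ⟨l, rfl⟩ := exists_lift_of_triangle₂ hY f (map_stalk_injective E _ _ (by
      rw [Functor.map_comp, hf, zero_comp, Functor.map_zero]))
    have hl : E.mapDerivedCategory.map l = 0 := by
      refine eq_zero_of_comp_mor₁_eq_zero (map_triangle E hY) (fun m => ?_) _
        (by rw [← Functor.map_comp, hf])
      exact h₂.torsionPair.hom_eq_zero_of_shiftedAisle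
        (shiftedAisle_shift ((aisle T₂).prop_of_iso (mapStalkIso E 0 V).symm
          (aisle_stalk h₂.self)))
        ((coaisle F₂).prop_of_iso (mapStalkIso E 0 A).symm
          (h₂.torsionPair.heart_stalk (hT A hA)).2) m
    rw [hbij.1 (hl.trans (Functor.map_zero _ _ _).symm), zero_comp]
  · intro g
    obtain ⟨q, hq⟩ := map_stalk_surjective E _ _ (g ≫ E.mapDerivedCategory.map p)
    obtain ⟨k, rfl⟩ := h₁.exists_lift_stalk hB hY q
    obtain ⟨l, hl⟩ := exists_lift_of_triangle₂ (map_triangle E hY) (g - E.mapDerivedCategory.map k)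
      (by rw [Preadditive.sub_comp, ← hq, Functor.map_comp, sub_self])
    obtain ⟨l, rfl⟩ := hbij.2 l
    exact ⟨l ≫ i + k, by rw [Functor.map_add, Functor.map_comp, ← hl, sub_add_cancel]⟩

variable [EnoughInjectives C]

lemma map_heart_injective [T₁.IsClosedUnderIsomorphisms] {X Y : DerivedCategory C}
    (hX : heart T₁ F₁ X) (hY : heart T₁ F₁ Y) :
    Function.Injective (E.mapDerivedCategory.map : (X ⟶ Y) → _) := by
  refine map_injective_of_eq_zero E fun f hf => ?_
  refine h₁.hom_eq_zero hX hY.2 f fun g => (map_self_bijective E h₁ h₂ hT hY).1 ?_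
  rw [Functor.map_comp, hf, comp_zero, Functor.map_zero]

include hF

variable [EnoughInjectives D] [∀ I : Type v, PreservesColimitsOfShape (Discrete I) E]

lemma map_coproduct_surjective {I : Type v} {c : Cofan fun _ : I => V} (hc : IsColimit c)
    {Y : DerivedCategory C} (hY : heart T₁ F₁ Y) :
    Function.Surjective (E.mapDerivedCategory.map :
      ((singleFunctor C 0).obj c.pt ⟶ Y) → _) := by
  intro g
  have := hY.2.1
  have := (heart_map E h₂ hT hF hY).2.1
  choose f hf using fun i => (map_self_bijective E h₁ h₂ hT hY).2
    (E.mapDerivedCategory.map ((singleFunctor C 0).map (c.inj i)) ≫ g)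
  obtain ⟨k, hk⟩ := exists_stalk_coproduct_desc hc (-1) f
  refine ⟨k, ?_⟩
  let d : Cofan fun _ : I => E.obj V := Cofan.mk (E.obj c.pt) fun i => E.map (c.inj i)
  have hd : IsColimit d := isColimitCofanMkObjOfIsColimit E _ _ hc
  rw [← cancel_epi (mapStalkIso E 0 c.pt).inv]
  refine stalk_coproduct_hom_ext hd (-1) fun i => ?_
  change (singleFunctor D 0).map (E.map (c.inj i)) ≫ _ =
    (singleFunctor D 0).map (E.map (c.inj i)) ≫ _
  rw [← Category.assoc, ← Category.assoc, ← mapStalkIso_inv_naturality, Category.assoc,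
    Category.assoc, ← hf, ← hk i, Functor.map_comp]

variable [T₁.IsClosedUnderIsomorphisms] [F₁.IsClosedUnderIsomorphisms] [HasCoproducts.{v} C]

lemma map_heart_surjective {X Y : DerivedCategory C} (hX : heart T₁ F₁ X) (hY : heart T₁ F₁ Y) :
    Function.Surjective (E.mapDerivedCategory.map : (X ⟶ Y) → _) := by
  intro g
  obtain ⟨I, c, hc, M, hM, a, p, δ, hX⟩ := h₁.exists_presentation hX
  have map_a_comp_p : (singleFunctor C 0).map a ≫ p = 0 := comp_distTriang_mor_zero₁₂ _ hX
  obtain ⟨k, hk⟩ := map_coproduct_surjective E h₁ h₂ hT hF hc hY (E.mapDerivedCategory.map p ≫ g)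
  obtain ⟨l, rfl⟩ := exists_desc_of_triangle₂ hX k
    (map_heart_injective E h₁ h₂ hT (h₁.torsionPair.heart_stalk hM) hY (by
      rw [Functor.map_comp, hk, ← Category.assoc, ← Functor.map_comp, map_a_comp_p,
        Functor.map_zero, zero_comp, Functor.map_zero]))
  refine ⟨l, ?_⟩
  rw [← sub_eq_zero]
  obtain ⟨m, hm⟩ := exists_desc_of_triangle₃ (map_triangle E hX) (E.mapDerivedCategory.map l - g)
    (by rw [Preadditive.comp_sub, ← Functor.map_comp, hk, sub_self])
  rw [hm, h₂.torsionPair.hom_eq_zero_of_shiftedAisle (shiftedAisle_shift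
    ((aisle T₂).prop_of_iso (mapStalkIso E 0 M).symm (aisle_stalk (hT M hM))))
    (heart_map E h₂ hT hF hY).2 m, comp_zero]

end HeartFunctor

section SubgenEquivalence

variable {R : Type u} [Ring R] {V : ModuleCat.{u} R}

lemma IsWeakTilting.kerHom_le_subgen (h : IsWeakTilting V) : kerHom V ≤ subgen V := h.embeds

lemma IsWeakTilting.isTorsionPair_subgen (h : IsWeakTilting V) :
    IsTorsionPair (torsionIn V) (torsionFreeIn V) := by
  have := hasColimitsOfSize_subgen h.gen_le_kerExt_one
  rw [torsionIn_eq h.gen_le_kerExt_one h.pres_eq_gen, torsionFreeIn_eq]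
  exact isTorsionPair_gen h.subgenSelf.gen_le_kerExt_one

variable [HasDerivedCategory.{w} (ModuleCat.{u} R)] [HasDerivedCategory.{t} (Subgen V)]

theorem IsWeakTilting.exists_isEquivalence (h : IsWeakTilting V) :
    ∃ h : ∀ X : DerivedCategory (Subgen V), heart (torsionIn V) (torsionFreeIn V) X →
        heart (pres V) (kerHom V) ((Subgen.incl V).mapDerivedCategory.obj X),
      (ObjectProperty.lift (heart (pres V) (kerHom V))
        ((heart (torsionIn V) (torsionFreeIn V)).ι ⋙ (Subgen.incl V).mapDerivedCategory)
        (fun X => h X.obj X.property)).IsEquivalence := by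
  have hV := h.gen_le_kerExt_one
  have := hasColimitsOfSize_subgen hV
  have := isGrothendieckAbelian_subgen hV
  have := fun I : Type u => preservesColimitsOfShape_incl hV (Discrete I)
  rw [torsionIn_eq hV h.pres_eq_gen, torsionFreeIn_eq, h.pres_eq_gen]
  have h₁ : IsTiltingTorsionPair (gen (Subgen.self V)) (kerHom (Subgen.self V)) (Subgen.self V) :=
    h.subgenSelf.isTiltingTorsionPair
  have h₂ : IsTiltingTorsionPair (gen V) (kerHom V) ((Subgen.incl V).obj (Subgen.self V)) :=
    h.isTiltingTorsionPair
  have hT := fun X => (gen_subgenSelf_iff hV X).1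
  have hF := fun X : Subgen V => (kerHom_subgenSelf_iff X).1
  refine ⟨fun X hX => heart_map _ h₂ hT hF hX, ?_⟩
  refine { faithful := ⟨fun {X Y f g} hfg => ?_⟩, full := ⟨fun {X Y} f => ?_⟩,
           essSurj := ⟨fun Y => ?_⟩ }
  · ext : 1
    exact map_heart_injective _ h₁ h₂ hT X.property Y.property
      (congr_arg (fun l => l.hom) hfg)
  · obtain ⟨g, hg⟩ := map_heart_surjective _ h₁ h₂ hT hF X.property Y.property f.hom
    exact ⟨ObjectProperty.homMk g, by ext : 1; exact hg⟩
  · obtain ⟨X, hX, ⟨e⟩⟩ := exists_heart_map_iso (Subgen.incl V) h₂ h₁.torsionPair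
      (fun Y hY => ⟨⟨Y, gen_le_subgen _ hY⟩, (gen_subgenSelf_iff hV _).2 hY, ⟨Iso.refl _⟩⟩)
      (fun X => (kerHom_subgenSelf_iff X).2) Y.property
    exact ⟨⟨X, hX⟩, ⟨ObjectProperty.isoMk _ e⟩⟩

end SubgenEquivalence

end TiltingHeart

end

theorem mainTheorem6 {R : Type u} [Ring R] (V : ModuleCat.{u} R)
    [HasDerivedCategory.{w} (ModuleCat.{u} R)]
    [HasDerivedCategory.{t} (TiltingHeart.Subgen V)] :
    (TiltingHeart.IsClassicalOneTilting V → TiltingHeart.StalkIsProgenerator V) ∧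
    (TiltingHeart.StalkIsProgenerator V ↔ TiltingHeart.IsStalkProgeneratorModule V) ∧
    (TiltingHeart.StalkIsProgenerator V ∨ TiltingHeart.IsStalkProgeneratorModule V →
      IsGrothendieckAbelian.{u} (TiltingHeart.Subgen V) ∧
      TiltingHeart.pres V ≤ TiltingHeart.subgen V ∧
      TiltingHeart.kerHom V ≤ TiltingHeart.subgen V ∧
      TiltingHeart.IsTorsionPair (TiltingHeart.torsionIn V) (TiltingHeart.torsionFreeIn V) ∧
      TiltingHeart.IsClassicalOneTilting (TiltingHeart.Subgen.self V) ∧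
      ∃ h : ∀ X : DerivedCategory (TiltingHeart.Subgen V),
          TiltingHeart.heart (TiltingHeart.torsionIn V) (TiltingHeart.torsionFreeIn V) X →
          TiltingHeart.heart (TiltingHeart.pres V) (TiltingHeart.kerHom V)
            ((TiltingHeart.Subgen.incl V).mapDerivedCategory.obj X),
        (ObjectProperty.lift
          (TiltingHeart.heart (TiltingHeart.pres V) (TiltingHeart.kerHom V))
          ((TiltingHeart.heart (TiltingHeart.torsionIn V) (TiltingHeart.torsionFreeIn V)).ι ⋙
            (TiltingHeart.Subgen.incl V).mapDerivedCategory)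
          (fun X => h X.obj X.property)).IsEquivalence) := by
  refine ⟨fun h => h.stalkIsProgenerator,
    ⟨fun h => h.isStalkProgeneratorModule, fun h => h.stalkIsProgenerator⟩, fun h => ?_⟩
  have h' : TiltingHeart.IsStalkProgeneratorModule V :=
    h.elim (fun h => h.isStalkProgeneratorModule) id
  have hW := h'.isWeakTilting
  have := h'.finitePresentation
  exact ⟨TiltingHeart.isGrothendieckAbelian_subgen hW.gen_le_kerExt_one,
    TiltingHeart.pres_le_gen.trans TiltingHeart.gen_le_subgen,
    hW.kerHom_le_subgen, hW.isTorsionPair_subgen, hW.isClassicalOneTilting_subgenSelf,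
    hW.exists_isEquivalence⟩
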